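/- Let $p,n\in\mathbb{N}$ and let $G$ be an undirected simple graph on the vertex set $[p]=\{1,\dots,p\}$ with $m$ edges and $n_c$ connected components. Let $\Gamma\in\{-1,0,1\}^{m\times p}$ be its oriented incidence matrix: the row of an edge $\{i,j\}$ has entry $1$ in column $\min(i,j)$, entry $-1$ in column $\max(i,j)$, and $0$ elsewhere. Let $\Gamma^\dagger\in\mathbb{R}^{p\times m}$ be the Moore–Penrose inverse of $\Gamma$, with columns $s_1,\dots,s_m$, and put $\rho(\Gamma)=\max_{1\le j\le m}\|s_j\|_2$. Let $\Sigma\in\mathbb{R}^{p\times p}$ be symmetric positive semidefinite, with largest eigenvalue $\gamma_{\max}(\Sigma)$ and positive semidefinite square root $\Sigma^{1/2}$. There are universal constants $c_1,c_2>0$ (independent of $n$, $p$, $G$, $\Sigma$ and $X$) such that the following holds. If $X\in\mathbb{R}^{n\times p}$ is a random matrix with i.i.d. $N(0,\Sigma)$ rows, $m\ge2$ and $n\ge10$, then the event that, simultaneously for all $v\in\mathbb{R}^p$, $$\frac{\|Xv\|_2}{\sqrt n}\ \ge\ \frac14\|\Sigma^{1/2}v\|_2-3\sqrt{\frac{\gamma_{\max}(\Sigma)\,n_c}{n}}\,\|v\|_2-6\sqrt2\,\rho(\Gamma)\sqrt{\frac{\gamma_{\max}(\Sigma)\log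 p}{n}}\,\|\Gamma v\|_1$$ has probability at least $1-c_1e^{-c_2n}$. -/

import Mathlib

open MeasureTheory ProbabilityTheory
open scoped Matrix MatrixOrder

noncomputable section

/-- The Euclidean norm of a real vector. -/
def l2Norm {ι : Type*} [Fintype ι] (x : ι → ℝ) : ℝ := ‖WithLp.toLp 2 x‖

/-- The `ℓ₁` norm of a real vector. -/
def l1Norm {ι : Type*} [Fintype ι] (x : ι → ℝ) : ℝ := ∑ i, |x i|

/-- The largest eigenvalue of a (nonempty, symmetric) real matrix. -/
def maxEigenvalue {ι : Type*} [Fintype ι] [DecidableEq ι] (M : Matrix ι ι ℝ) : ℝ :=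
  sSup (spectrum ℝ M)

/-- The oriented edge-vertex incidence matrix of a simple graph on an ordered vertex set:
the row of the edge `{i, j}` has entry `1` at `min i j`, entry `-1` at `max i j`, and `0`
elsewhere. -/
def incidence {V : Type*} [LinearOrder V] (G : SimpleGraph V) : Matrix G.edgeSet V ℝ :=
  Matrix.of fun e k => if k = e.1.inf then 1 else if k = e.1.sup then -1 else 0

/-- The four Penrose conditions: `B` is a Moore-Penrose inverse of the real matrix `A`. -/
structure IsMoorePenrose {ι κ : Type*} [Fintype ι] [Fintype κ]
    (A : Matrix ι κ ℝ) (B : Matrix κ ι ℝ) : Prop where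
  mul_mul_self : A * B * A = A
  mul_mul_inv : B * A * B = B
  symm_mul_inv : (A * B)ᵀ = A * B
  symm_inv_mul : (B * A)ᵀ = B * A

theorem IsMoorePenrose.unique {ι κ : Type*} [Fintype ι] [Fintype κ] {A : Matrix ι κ ℝ}
    {B C : Matrix κ ι ℝ} (hB : IsMoorePenrose A B) (hC : IsMoorePenrose A C) : B = C := by
  have h1 : A * B = A * C := by
    calc A * B = (A * B)ᵀ := hB.symm_mul_inv.symm
      _ = ((A * C) * (A * B))ᵀ := by rw [← Matrix.mul_assoc, hC.mul_mul_self]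
      _ = (A * B) * (A * C) := by
        rw [Matrix.transpose_mul, hB.symm_mul_inv, hC.symm_mul_inv]
      _ = A * C := by rw [← Matrix.mul_assoc, hB.mul_mul_self]
  have h2 : B * A = C * A := by
    calc B * A = (B * A)ᵀ := hB.symm_inv_mul.symm
      _ = ((B * A) * (C * A))ᵀ := by
        rw [Matrix.mul_assoc B A, ← Matrix.mul_assoc A C, hC.mul_mul_self]
      _ = (C * A) * (B * A) := by
        rw [Matrix.transpose_mul, hB.symm_inv_mul, hC.symm_inv_mul]
      _ = C * A := by rw [Matrix.mul_assoc C A, ← Matrix.mul_assoc A B, hB.mul_mul_self]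
  calc B = B * A * B := hB.mul_mul_inv.symm
    _ = C * A * C := by rw [h2, Matrix.mul_assoc, h1, ← Matrix.mul_assoc]
    _ = C := hC.mul_mul_inv

theorem exists_isMoorePenrose {ι κ : Type*} [Fintype ι] [Fintype κ] (A : Matrix ι κ ℝ) :
    ∃ B : Matrix κ ι ℝ, IsMoorePenrose A B := by
  classical
  have hH : (Aᵀ * A).IsHermitian := by
    simpa using Matrix.isHermitian_conjTranspose_mul_self A
  have hS : IsSelfAdjoint (Aᵀ * A) := hH
  have hfin : (spectrum ℝ (Aᵀ * A)).Finite := by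
    rw [hH.spectrum_real_eq_range_eigenvalues]; exact Set.finite_range _
  have hc : ∀ f : ℝ → ℝ, ContinuousOn f (spectrum ℝ (Aᵀ * A)) := fun f => hfin.continuousOn f
  obtain ⟨Q, hQ⟩ : ∃ Q, Q = cfc (fun x : ℝ => x⁻¹) (Aᵀ * A) := ⟨_, rfl⟩
  have hid : cfc (fun x : ℝ => x) (Aᵀ * A) = Aᵀ * A := cfc_id' ℝ _
  have hQs : Qᵀ = Q := by
    have : IsSelfAdjoint Q := hQ ▸ cfc_predicate _ _
    simpa [IsSelfAdjoint, Matrix.star_eq_conjTranspose] using this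
  have hQA : Q * (Aᵀ * A) = cfc (fun x : ℝ => x⁻¹ * x) (Aᵀ * A) := by
    rw [cfc_mul _ _ _ (hc _) (hc _), ← hQ, hid]
  have hQAs : (Q * (Aᵀ * A))ᵀ = Q * (Aᵀ * A) := by
    have : IsSelfAdjoint (Q * (Aᵀ * A)) := hQA ▸ cfc_predicate _ _
    simpa [IsSelfAdjoint, Matrix.star_eq_conjTranspose] using this
  have hAQA : (Aᵀ * A) * (Q * (Aᵀ * A)) = Aᵀ * A := by
    rw [hQA]
    nth_rewrite 1 [← hid]
    rw [← cfc_mul _ _ _ (hc _) (hc _)]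
    nth_rewrite 2 [← hid]
    refine cfc_congr fun x _ => ?_
    by_cases hx : x = 0 <;> simp [hx]
  have hQAQ : Q * (Aᵀ * A) * Q = Q := by
    rw [hQA, hQ, ← cfc_mul _ _ _ (hc _) (hc _)]
    refine cfc_congr fun x _ => ?_
    by_cases hx : x = 0 <;> simp [hx]
  have key : A * (Q * (Aᵀ * A)) = A := by
    have h : Aᴴ * A * (Q * (Aᵀ * A) - 1) = 0 := by
      rw [Matrix.conjTranspose_eq_transpose_of_trivial, Matrix.mul_sub, hAQA, Matrix.mul_one,
        sub_self]
    have h' := (Matrix.conjTranspose_mul_self_mul_eq_zero A _).1 h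
    rwa [Matrix.mul_sub, Matrix.mul_one, sub_eq_zero] at h'
  refine ⟨Q * Aᵀ, ?_, ?_, ?_, ?_⟩
  · rw [Matrix.mul_assoc, Matrix.mul_assoc Q, key]
  · rw [Matrix.mul_assoc Q, ← Matrix.mul_assoc (Q * (Aᵀ * A)), hQAQ]
  · simp [Matrix.transpose_mul, hQs, Matrix.mul_assoc]
  · rw [Matrix.mul_assoc, hQAs]

/-- The Moore-Penrose inverse of a real matrix: the unique matrix with the Penrose conditions. -/
def pinv {ι κ : Type*} [Fintype ι] [Fintype κ] (A : Matrix ι κ ℝ) : Matrix κ ι ℝ :=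
  (exists_isMoorePenrose A).choose

theorem isMoorePenrose_pinv {ι κ : Type*} [Fintype ι] [Fintype κ] (A : Matrix ι κ ℝ) :
    IsMoorePenrose A (pinv A) :=
  (exists_isMoorePenrose A).choose_spec

/-- The inverse scaling factor of a matrix with finitely many (and at least one) rows: the
largest Euclidean norm of a column of its Moore-Penrose inverse. -/
def invScaling {ι κ : Type*} [Fintype ι] [Fintype κ] (A : Matrix ι κ ℝ) : ℝ :=
  ⨆ j : ι, l2Norm fun k => pinv A k j

end

/-!
The argument is a lower-tail bound for the empirical process `v ↦ n⁻¹ ∑ᵢ |⟨xᵢ, v⟩|`, which is at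
most `‖X v‖₂ / √n`. After scaling to `‖Σ^{1/2} v‖₂ = 1` its mean is `√(2 / π) > 3 / 8`, and the
excess of `3 / 8` over `1 / 4` pays for the constants below. Write `b v` for the sum of the two
penalty terms. By continuity in `v` only finitely many vectors need to be treated at a time, with a
bound that does not depend on their number.

Chernoff's bound asks for an exponential moment of `max_v (∑ᵢ (3 / 8 - |⟨xᵢ, v⟩|) - n b v)`.
Symmetrisation and contraction, done for one sample at a time (`lintegral_exp_iSup_sub_abs_le`,
`lintegral_pi_sum_le`), replace each summand by the linear term `2 ⟨xᵢ, v⟩`. What is left is the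
exponential moment of the maximum of finitely many affine functionals of a Gaussian vector, whose
linear parts all have the same variance. The Maurey–Pisier rotation argument
(`lintegral_exp_iSup_mul_measure_le`) bounds this moment in terms of the variance alone as soon as
the maximum is nonpositive with probability at least `1 / 2`.

That last condition is where the graph enters (`half_le_measure_process_le`). With `h = ∑ᵢ xᵢ`,
`Π = 1 - Γ⁺ Γ` and the columns `sⱼ` of `Γ⁺`,
`⟨h, v⟩ = ⟨Π h, v⟩ + ∑ⱼ ⟨h, sⱼ⟩ (Γ v)ⱼ ≤ ‖Π h‖₂ ‖v‖₂ + maxⱼ |⟨h, sⱼ⟩| ‖Γ v‖₁`.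
The projection `Π` has trace `dim ker Γ = n_c`, so Markov's inequality controls `‖Π h‖₂`, and the
Gaussian tail with a union bound over the at most `p ^ 2 / 2` edges controls the maximum.
-/

/-! ### Gaussian concentration for maxima of affine functionals -/

section Concentration

variable {ι : Type*} [Fintype ι] {E : Type*} [NormedAddCommGroup E] [NormedSpace ℝ E]

/-- The smoothed maximum `β⁻¹ log ∑ₖ exp (β aₖ)` of finitely many real numbers; it exceeds the
maximum by at most `β⁻¹ log (card ι)`. -/
noncomputable def softMax (β : ℝ) (a : ι → ℝ) : ℝ := β⁻¹ * Real.log (∑ k, Real.exp (β * a k))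

/-- The Gibbs weights `exp (β aₖ) / ∑ₗ exp (β aₗ)`, the gradient of `softMax β` at `a`. -/
noncomputable def gibbsWeight (β : ℝ) (a : ι → ℝ) (k : ι) : ℝ :=
  Real.exp (β * a k) / ∑ l, Real.exp (β * a l)

lemma sum_exp_pos [Nonempty ι] (β : ℝ) (a : ι → ℝ) : 0 < ∑ k, Real.exp (β * a k) :=
  Finset.sum_pos (fun _ _ => Real.exp_pos _) Finset.univ_nonempty

lemma gibbsWeight_nonneg (β : ℝ) (a : ι → ℝ) (k : ι) : 0 ≤ gibbsWeight β a k := by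
  unfold gibbsWeight; positivity

lemma sum_gibbsWeight [Nonempty ι] (β : ℝ) (a : ι → ℝ) : ∑ k, gibbsWeight β a k = 1 := by
  unfold gibbsWeight
  rw [← Finset.sum_div, div_self (sum_exp_pos β a).ne']

lemma iSup_le_softMax [Nonempty ι] {β : ℝ} (hβ : 0 < β) (a : ι → ℝ) :
    ⨆ k, a k ≤ softMax β a := by
  refine ciSup_le fun k => ?_
  rw [softMax, ← div_eq_inv_mul, le_div_iff₀ hβ, mul_comm, Real.le_log_iff_exp_le (sum_exp_pos β a)]
  exact Finset.single_le_sum (f := fun k => Real.exp (β * a k))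
    (fun _ _ => (Real.exp_pos _).le) (Finset.mem_univ k)

lemma softMax_le [Nonempty ι] {β : ℝ} (hβ : 0 < β) {a : ι → ℝ} (ha : ∀ k, a k ≤ 0) :
    softMax β a ≤ β⁻¹ * Real.log (Fintype.card ι) := by
  unfold softMax
  gcongr
  calc ∑ k, Real.exp (β * a k) ≤ ∑ _k : ι, (1 : ℝ) := Finset.sum_le_sum fun k _ =>
        Real.exp_le_one_iff.2 (mul_nonpos_of_nonneg_of_nonpos hβ.le (ha k))
    _ = Fintype.card ι := by simp

lemma hasDerivAt_softMax [Nonempty ι] {β : ℝ} (hβ : 0 < β) {a : ℝ → ι → ℝ} {a' : ι → ℝ} {t : ℝ}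
    (ha : ∀ k, HasDerivAt (fun s => a s k) (a' k) t) :
    HasDerivAt (fun s => softMax β (a s)) (∑ k, gibbsWeight β (a t) k * a' k) t := by
  have h1 : HasDerivAt (fun s => ∑ k, Real.exp (β * a s k))
      (∑ k, Real.exp (β * a t k) * (β * a' k)) t :=
    HasDerivAt.fun_sum fun k _ => ((ha k).const_mul β).exp
  refine ((h1.log (sum_exp_pos β (a t)).ne').const_mul β⁻¹).congr_deriv ?_
  rw [Finset.sum_div, Finset.mul_sum]
  refine Finset.sum_congr rfl fun k _ => ?_
  have := (sum_exp_pos β (a t)).ne'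
  unfold gibbsWeight
  field_simp

lemma continuous_gibbsWeight [Nonempty ι] (β : ℝ) (k : ι) :
    Continuous fun a : ι → ℝ => gibbsWeight β a k := by
  unfold gibbsWeight
  exact Continuous.div (by fun_prop) (by fun_prop) fun a => (sum_exp_pos β a).ne'

lemma continuous_softMax [Nonempty ι] (β : ℝ) : Continuous fun a : ι → ℝ => softMax β a := by
  unfold softMax
  exact continuous_const.mul (Continuous.log (by fun_prop) fun a => (sum_exp_pos β a).ne')

/-- Jensen's inequality for the exponential and the uniform distribution on `[0, T]`. -/
lemma exp_integral_le {T : ℝ} (hT : 0 < T) {h : ℝ → ℝ} (hh : Continuous h) :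
    Real.exp (∫ t in (0)..T, h t) ≤ T⁻¹ * ∫ t in (0)..T, Real.exp (T * h t) := by
  set m := ∫ t in (0)..T, h t with hm
  have hc : ∀ {f : ℝ → ℝ}, Continuous f → IntervalIntegrable f volume 0 T :=
    fun hf => hf.intervalIntegrable _ _
  have h1 : ∫ t in (0)..T, Real.exp m * (1 - m + T * h t) ≤ ∫ t in (0)..T, Real.exp (T * h t) := by
    refine intervalIntegral.integral_mono_on hT.le (hc (by fun_prop)) (hc (by fun_prop)) ?_
    intro t _
    have h2 := Real.add_one_le_exp (T * h t - m)
    calc Real.exp m * (1 - m + T * h t) ≤ Real.exp m * Real.exp (T * h t - m) := by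
          gcongr; linarith
      _ = Real.exp (T * h t) := by rw [← Real.exp_add]; ring_nf
  rw [intervalIntegral.integral_const_mul, intervalIntegral.integral_add
    (hc continuous_const) (hc (by fun_prop : Continuous fun t => T * h t)),
    intervalIntegral.integral_const_mul, ← hm] at h1
  simp only [intervalIntegral.integral_const, sub_zero, smul_eq_mul] at h1
  rw [← div_eq_inv_mul, le_div_iff₀ hT]
  linarith

/-- The derivative of the smoothed maximum of the functionals `L k + b k` at the point `z.1` along
the direction `z.2`. -/
noncomputable def softMaxDeriv (β : ℝ) (L : ι → StrongDual ℝ E) (b : ι → ℝ) (z : E × E) : ℝ :=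
  ∑ k, gibbsWeight β (fun l => L l z.1 + b l) k * L k z.2

lemma continuous_softMaxDeriv [Nonempty ι] (β : ℝ) (L : ι → StrongDual ℝ E) (b : ι → ℝ) :
    Continuous (softMaxDeriv β L b) := by
  unfold softMaxDeriv
  refine continuous_finsetSum _ fun k _ => ?_
  have h1 : Continuous fun z : E × E => fun l => L l z.1 + b l := by fun_prop
  have h2 : Continuous fun z : E × E => L k z.2 := by fun_prop
  exact ((continuous_gibbsWeight β k).comp h1).mul h2

lemma continuous_rotation : Continuous fun q : ℝ × E × E =>
    ContinuousLinearMap.rotation q.1 q.2 := by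
  simp only [ContinuousLinearMap.rotation_apply]
  exact ((Real.continuous_cos.comp continuous_fst).smul (continuous_fst.comp continuous_snd)
    |>.add ((Real.continuous_sin.comp continuous_fst).smul (continuous_snd.comp continuous_snd)))
    |>.prodMk (((Real.continuous_sin.comp continuous_fst).neg.smul
      (continuous_fst.comp continuous_snd)).add
      ((Real.continuous_cos.comp continuous_fst).smul (continuous_snd.comp continuous_snd)))

/-- The increment of the smoothed maximum from `x` to `y` is the integral of its derivative along
the quarter circle `cos θ x + sin θ y`; Jensen's inequality then moves the exponential inside. -/
lemma exp_softMax_sub_le [Nonempty ι] {β : ℝ} (hβ : 0 < β) (L : ι → StrongDual ℝ E) (b : ι → ℝ)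
    (z : E × E) :
    ENNReal.ofReal (Real.exp (softMax β (fun k => L k z.2 + b k)
      - softMax β (fun k => L k z.1 + b k))) ≤
    ENNReal.ofReal (Real.pi / 2)⁻¹ * ∫⁻ θ in Set.Ioc 0 (Real.pi / 2), ENNReal.ofReal (Real.exp
      (Real.pi / 2 * softMaxDeriv β L b (ContinuousLinearMap.rotation θ z))) := by
  have hcont : Continuous fun θ : ℝ => softMaxDeriv β L b (ContinuousLinearMap.rotation θ z) :=
    (continuous_softMaxDeriv β L b).comp
      (continuous_rotation.comp (f := fun θ : ℝ => (θ, z)) (by fun_prop))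
  have hd : ∀ θ : ℝ, HasDerivAt
      (fun s => softMax β fun k => L k (ContinuousLinearMap.rotation s z).1 + b k)
      (softMaxDeriv β L b (ContinuousLinearMap.rotation θ z)) θ := by
    intro θ
    refine hasDerivAt_softMax hβ fun k => ?_
    have h1 := (((Real.hasDerivAt_cos θ).mul_const (L k z.1)).add
      ((Real.hasDerivAt_sin θ).mul_const (L k z.2))).add_const (b k)
    refine (h1.congr_of_eventuallyEq (Filter.Eventually.of_forall fun s => ?_)).congr_deriv ?_
    · simp [ContinuousLinearMap.rotation_apply]
    · simp [ContinuousLinearMap.rotation_apply]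
  have hint := intervalIntegral.integral_eq_sub_of_hasDerivAt (a := 0) (b := Real.pi / 2)
    (fun θ _ => hd θ) (hcont.intervalIntegrable _ _)
  simp only [ContinuousLinearMap.rotation_apply, Real.cos_pi_div_two, Real.sin_pi_div_two,
    Real.cos_zero, Real.sin_zero, zero_smul, one_smul, zero_add, add_zero] at hint
  have hJ := exp_integral_le Real.pi_div_two_pos hcont
  simp only [ContinuousLinearMap.rotation_apply] at hJ ⊢
  rw [hint] at hJ
  refine (ENNReal.ofReal_le_ofReal hJ).trans ?_
  rw [ENNReal.ofReal_mul (by positivity), intervalIntegral.integral_of_le Real.pi_div_two_pos.le,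
    ofReal_integral_eq_lintegral_ofReal]
  · simp only [ContinuousLinearMap.rotation_apply] at hcont
    exact (Continuous.intervalIntegrable (by fun_prop) _ _).1
  · exact ae_of_all _ fun _ => (Real.exp_pos _).le

variable [MeasurableSpace E] [BorelSpace E] [SecondCountableTopology E] [CompleteSpace E]

lemma map_dual_of_centered (η : Measure E) [IsGaussian η] (hη : ∫ x, x ∂η = 0)
    (L : StrongDual ℝ E) : η.map L = gaussianReal 0 (Var[L; η]).toNNReal := by
  rw [IsGaussian.map_eq_gaussianReal, IsGaussian.integral_dual, hη, map_zero]

lemma lintegral_exp_dual (η : Measure E) [IsGaussian η] (hη : ∫ x, x ∂η = 0)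
    (L : StrongDual ℝ E) (t : ℝ) :
    ∫⁻ x, ENNReal.ofReal (Real.exp (t * L x)) ∂η =
      ENNReal.ofReal (Real.exp (t ^ 2 * Var[L; η] / 2)) := by
  have hmap := map_dual_of_centered η hη L
  have hi : Integrable (fun x => Real.exp (t * L x)) η := by
    have := integrable_exp_mul_gaussianReal (μ := 0) (v := (Var[L; η]).toNNReal) t
    rw [← hmap, integrable_map_measure (by fun_prop) (by fun_prop)] at this
    exact this
  rw [← ofReal_integral_eq_lintegral_ofReal hi (ae_of_all _ fun _ => (Real.exp_pos _).le)]
  have := mgf_gaussianReal hmap t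
  rw [mgf] at this
  rw [this, Real.coe_toNNReal _ (variance_nonneg _ _)]
  ring_nf

lemma lintegral_exp_softMaxDeriv_le [Nonempty ι] (β : ℝ) (η : Measure E) [IsGaussian η]
    (hη : ∫ x, x ∂η = 0) (L : ι → StrongDual ℝ E) (b : ι → ℝ) {s : ℝ}
    (hs : ∀ k, Var[L k; η] ≤ s) (t : ℝ) :
    ∫⁻ z, ENNReal.ofReal (Real.exp (t * softMaxDeriv β L b z)) ∂(η.prod η) ≤
      ENNReal.ofReal (Real.exp (t ^ 2 * s / 2)) := by
  have hc := continuous_softMaxDeriv β L b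
  rw [lintegral_prod _ (by fun_prop)]
  have key : ∀ x : E, ∫⁻ y, ENNReal.ofReal (Real.exp (t * softMaxDeriv β L b (x, y))) ∂η ≤
      ENNReal.ofReal (Real.exp (t ^ 2 * s / 2)) := by
    intro x
    obtain ⟨w, hw⟩ : ∃ w, w = gibbsWeight β (fun l => L l x + b l) := ⟨_, rfl⟩
    have hw0 : ∀ k, 0 ≤ w k := fun k => hw ▸ gibbsWeight_nonneg β _ k
    have hw1 : ∑ k, w k = 1 := hw ▸ sum_gibbsWeight β _
    calc ∫⁻ y, ENNReal.ofReal (Real.exp (t * softMaxDeriv β L b (x, y))) ∂η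
        ≤ ∫⁻ y, ∑ k, ENNReal.ofReal (w k) * ENNReal.ofReal (Real.exp (t * L k y)) ∂η := by
          refine lintegral_mono fun y => ?_
          simp_rw [← ENNReal.ofReal_mul (hw0 _)]
          rw [← ENNReal.ofReal_sum_of_nonneg fun k _ => mul_nonneg (hw0 k) (Real.exp_pos _).le]
          refine ENNReal.ofReal_le_ofReal ?_
          have := convexOn_exp.map_sum_le (t := Finset.univ) (w := w) (p := fun k => t * L k y)
            (fun k _ => hw0 k) hw1 fun _ _ => Set.mem_univ _
          simp only [smul_eq_mul] at this
          refine le_trans (le_of_eq ?_) this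
          rw [softMaxDeriv, Finset.mul_sum]
          congr 1
          exact Finset.sum_congr rfl fun k _ => by simp only [hw]; ring
      _ = ∑ k, ENNReal.ofReal (w k) * ENNReal.ofReal (Real.exp (t ^ 2 * Var[L k; η] / 2)) := by
          rw [lintegral_finsetSum _ fun k _ => by fun_prop]
          refine Finset.sum_congr rfl fun k _ => ?_
          rw [lintegral_const_mul _ (by fun_prop), lintegral_exp_dual η hη]
      _ ≤ ∑ k, ENNReal.ofReal (w k) * ENNReal.ofReal (Real.exp (t ^ 2 * s / 2)) := by
          gcongr with k
          exact hs k
      _ = ENNReal.ofReal (Real.exp (t ^ 2 * s / 2)) := by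
          rw [← Finset.sum_mul, ← ENNReal.ofReal_sum_of_nonneg fun k _ => hw0 k, hw1,
            ENNReal.ofReal_one, one_mul]
  calc _ ≤ ∫⁻ _ : E, ENNReal.ofReal (Real.exp (t ^ 2 * s / 2)) ∂η := lintegral_mono key
    _ = _ := by simp

/-- The Maurey–Pisier argument: for independent copies `x, y` of a centred Gaussian vector each
`ContinuousLinearMap.rotation θ (x, y)` has the law of `(x, y)`, so along the quarter circle the
derivative is, given the position, a Gaussian variable of variance at most `s`. -/
lemma lintegral_exp_softMax_sub_le [Nonempty ι] {β : ℝ} (hβ : 0 < β) (η : Measure E) [IsGaussian η]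
    (hη : ∫ x, x ∂η = 0) (L : ι → StrongDual ℝ E) (b : ι → ℝ) {s : ℝ}
    (hs : ∀ k, Var[L k; η] ≤ s) :
    ∫⁻ z, ENNReal.ofReal (Real.exp (softMax β (fun k => L k z.2 + b k)
      - softMax β (fun k => L k z.1 + b k))) ∂(η.prod η) ≤
      ENNReal.ofReal (Real.exp (Real.pi ^ 2 * s / 8)) := by
  have hc := continuous_softMaxDeriv β L b
  have hm : Continuous fun q : (E × E) × ℝ => ENNReal.ofReal (Real.exp
      (Real.pi / 2 * softMaxDeriv β L b (ContinuousLinearMap.rotation q.2 q.1))) := by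
    have := hc.comp (continuous_rotation.comp
      (continuous_snd.prodMk continuous_fst : Continuous fun q : (E × E) × ℝ => (q.2, q.1)))
    exact ENNReal.continuous_ofReal.comp (Real.continuous_exp.comp (continuous_const.mul this))
  refine (lintegral_mono fun z => exp_softMax_sub_le hβ L b z).trans ?_
  rw [lintegral_const_mul' _ _ ENNReal.ofReal_ne_top,
    lintegral_lintegral_swap hm.measurable.aemeasurable]
  have key : ∀ θ : ℝ, ∫⁻ z, ENNReal.ofReal (Real.exp
      (Real.pi / 2 * softMaxDeriv β L b (ContinuousLinearMap.rotation θ z))) ∂(η.prod η) ≤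
      ENNReal.ofReal (Real.exp (Real.pi ^ 2 * s / 8)) := by
    intro θ
    have hrot := IsGaussian.map_rotation_eq_self (μ := η) (by simpa using hη) θ
    rw [← lintegral_map (μ := η.prod η)
      (f := fun z => ENNReal.ofReal (Real.exp (Real.pi / 2 * softMaxDeriv β L b z)))
      (by fun_prop) (by fun_prop), hrot]
    refine (lintegral_exp_softMaxDeriv_le β η hη L b hs _).trans_eq ?_
    ring_nf
  calc _ ≤ ENNReal.ofReal (Real.pi / 2)⁻¹ * ∫⁻ _ in Set.Ioc (0 : ℝ) (Real.pi / 2),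
        ENNReal.ofReal (Real.exp (Real.pi ^ 2 * s / 8)) := by
        gcongr with θ
        exact key θ
    _ = _ := by
        rw [setLIntegral_const, Real.volume_Ioc, mul_comm (ENNReal.ofReal _) (ENNReal.ofReal _),
          ← mul_assoc, ← ENNReal.ofReal_mul (by positivity)]
        simp only [sub_zero]
        rw [inv_mul_cancel₀ Real.pi_div_two_pos.ne', ENNReal.ofReal_one, one_mul]

/-- Concentration for the maximum `F` of finitely many affine functionals of a centred Gaussian
vector: the exponential moment of `F` is controlled by the probability of `F ≤ 0`, with constants
that do not depend on the number of functionals. -/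
theorem lintegral_exp_iSup_mul_measure_le [Nonempty ι] (η : Measure E) [IsGaussian η]
    (hη : ∫ x, x ∂η = 0) (L : ι → StrongDual ℝ E) (b : ι → ℝ) {s : ℝ}
    (hs : ∀ k, Var[L k; η] ≤ s) :
    (∫⁻ x, ENNReal.ofReal (Real.exp (⨆ k, (L k x + b k))) ∂η) * η {x | ∀ k, L k x + b k ≤ 0} ≤
      ENNReal.ofReal (Real.exp (1 + Real.pi ^ 2 * s / 8)) := by
  have hcard : (1 : ℝ) ≤ Fintype.card ι := by exact_mod_cast Fintype.card_pos
  -- this `β` makes the smoothing error `β⁻¹ log (card ι)` at most `1`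
  set β : ℝ := Real.log (Fintype.card ι) + 1 with hβdef
  have hβ : 0 < β := by have := Real.log_nonneg hcard; positivity
  have herr : β⁻¹ * Real.log (Fintype.card ι) ≤ 1 := by
    rw [← div_eq_inv_mul, div_le_one hβ]; linarith
  set A : Set E := {x | ∀ k, L k x + b k ≤ 0} with hA
  have hAm : MeasurableSet A := by
    have : IsClosed A := by
      simp only [hA, Set.ofPred_forall]
      exact isClosed_iInter fun k => isClosed_le (by fun_prop) continuous_const
    exact this.measurableSet
  have hcs : Continuous fun x : E => softMax β fun k => L k x + b k :=
    (continuous_softMax β).comp (by fun_prop)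
  have hcm : Measurable fun x : E =>
      ENNReal.ofReal (Real.exp (softMax β fun k => L k x + b k)) :=
    ENNReal.measurable_ofReal.comp (Real.measurable_exp.comp hcs.measurable)
  calc (∫⁻ x, ENNReal.ofReal (Real.exp (⨆ k, (L k x + b k))) ∂η) * η A
      ≤ (∫⁻ y, ENNReal.ofReal (Real.exp (softMax β fun k => L k y + b k)) ∂η) *
        ∫⁻ x, A.indicator 1 x ∂η := by
        rw [lintegral_indicator_one hAm]
        gcongr with y
        exact iSup_le_softMax hβ _
    _ = ∫⁻ z, A.indicator 1 z.1 *
          ENNReal.ofReal (Real.exp (softMax β fun k => L k z.2 + b k)) ∂(η.prod η) := by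
        rw [mul_comm, ← lintegral_prod_mul (measurable_one.indicator hAm).aemeasurable
          hcm.aemeasurable]
    _ ≤ ∫⁻ z, ENNReal.ofReal (Real.exp 1) *
          ENNReal.ofReal (Real.exp (softMax β (fun k => L k z.2 + b k)
            - softMax β (fun k => L k z.1 + b k))) ∂(η.prod η) := by
        refine lintegral_mono fun z => ?_
        rw [← ENNReal.ofReal_mul (Real.exp_pos _).le, ← Real.exp_add]
        by_cases hz : z.1 ∈ A
        · rw [Set.indicator_of_mem hz, Pi.one_apply, one_mul]
          have := (softMax_le hβ hz).trans herr
          gcongr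
          linarith
        · simp [Set.indicator_of_notMem hz]
    _ ≤ ENNReal.ofReal (Real.exp 1) * ENNReal.ofReal (Real.exp (Real.pi ^ 2 * s / 8)) := by
        rw [lintegral_const_mul' _ _ ENNReal.ofReal_ne_top]
        gcongr
        exact lintegral_exp_softMax_sub_le hβ η hη L b hs
    _ = _ := by rw [← ENNReal.ofReal_mul (Real.exp_pos _).le, ← Real.exp_add]

end Concentration

/-! ### Symmetrisation and contraction -/

lemma ofReal_exp_integral_le {α : Type*} [MeasurableSpace α] {μ : Measure α}
    [IsProbabilityMeasure μ] {f : α → ℝ} (hf : Integrable f μ) :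
    ENNReal.ofReal (Real.exp (∫ x, f x ∂μ)) ≤ ∫⁻ x, ENNReal.ofReal (Real.exp (f x)) ∂μ := by
  set m := ∫ x, f x ∂μ with hm
  -- the tangent of `exp` at `m` lies below `exp`
  set g : α → ℝ := fun x => Real.exp m * (1 + (f x - m)) with hg
  have hgi : Integrable g μ :=
    ((integrable_const 1).add (hf.sub (integrable_const m))).const_mul _
  have hgm : ∫ x, g x ∂μ = Real.exp m := by
    have hfm : Integrable (fun x => f x - m) μ := hf.sub (integrable_const m)
    rw [hg, integral_const_mul, integral_add (integrable_const 1) hfm,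
      integral_sub hf (integrable_const m), ← hm]
    simp
  calc ENNReal.ofReal (Real.exp m) = ENNReal.ofReal (∫ x, g x ∂μ) := by rw [hgm]
    _ ≤ ENNReal.ofReal (∫ x, max (g x) 0 ∂μ) :=
        ENNReal.ofReal_le_ofReal (integral_mono hgi hgi.pos_part fun x => le_max_left _ _)
    _ = ∫⁻ x, ENNReal.ofReal (max (g x) 0) ∂μ :=
        ofReal_integral_eq_lintegral_ofReal hgi.pos_part (ae_of_all _ fun _ => le_max_right _ _)
    _ ≤ ∫⁻ x, ENNReal.ofReal (Real.exp (f x)) ∂μ := by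
        refine lintegral_mono fun x => ENNReal.ofReal_le_ofReal (max_le ?_ (Real.exp_pos _).le)
        calc g x ≤ Real.exp m * Real.exp (f x - m) := by
              have := Real.add_one_le_exp (f x - m)
              simp only [hg]
              gcongr
              linarith
          _ = Real.exp (f x) := by rw [← Real.exp_add]; ring_nf

section Symmetrisation

variable {ι : Type*} [Fintype ι] {E : Type*} [NormedAddCommGroup E] [NormedSpace ℝ E]
  [MeasurableSpace E]

lemma le_iSup_of_fintype (a : ι → ℝ) (k : ι) : a k ≤ ⨆ l, a l :=
  le_ciSup (Set.finite_range a).bddAbove k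

/-- The contraction principle for the absolute value and a single sign: the two maxima on the
right dominate, in decreasing order, the two maxima on the left. -/
lemma exp_iSup_abs_add_le [Nonempty ι] (a t : ι → ℝ) :
    Real.exp (⨆ k, (a k + |t k|)) + Real.exp (⨆ k, (a k - |t k|)) ≤
      Real.exp (⨆ k, (a k + t k)) + Real.exp (⨆ k, (a k + -t k)) := by
  set U := ⨆ k, (a k + t k) with hU
  set V := ⨆ k, (a k + -t k) with hV
  have hUk : ∀ k, a k + t k ≤ U := le_iSup_of_fintype fun k => a k + t k
  have hVk : ∀ k, a k + -t k ≤ V := le_iSup_of_fintype fun k => a k + -t k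
  have h1 : ⨆ k, (a k + |t k|) ≤ max U V := ciSup_le fun k => by
    rcases abs_cases (t k) with h | h <;> rw [h.1]
    · exact (hUk k).trans (le_max_left _ _)
    · exact (hVk k).trans (le_max_right _ _)
  have h2 : ⨆ k, (a k - |t k|) ≤ min U V := ciSup_le fun k => le_min
    (by linarith [hUk k, neg_abs_le (t k)]) (by linarith [hVk k, le_abs_self (t k)])
  rcases le_total U V with h | h
  · rw [max_eq_right h] at h1
    rw [min_eq_left h] at h2
    linarith [Real.exp_le_exp.2 h1, Real.exp_le_exp.2 h2]
  · rw [max_eq_left h] at h1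
    rw [min_eq_right h] at h2
    linarith [Real.exp_le_exp.2 h1, Real.exp_le_exp.2 h2]

/-- A maximum over a sum is at most the half-sum of the maxima for the doubled increments, and
`exp` of a half-sum is at most the half-sum of the exponentials. -/
lemma exp_iSup_add_sub_le [Nonempty ι] (a u w : ι → ℝ) :
    Real.exp (⨆ k, (a k + u k - w k)) ≤
      (Real.exp (⨆ k, (a k + 2 * u k)) + Real.exp (⨆ k, (a k - 2 * w k))) / 2 := by
  set U := ⨆ k, (a k + 2 * u k)
  set W := ⨆ k, (a k - 2 * w k)
  have h1 : ⨆ k, (a k + u k - w k) ≤ (1 / 2) * U + (1 / 2) * W := ciSup_le fun k => by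
    linarith [le_iSup_of_fintype (fun k => a k + 2 * u k) k,
      le_iSup_of_fintype (fun k => a k - 2 * w k) k]
  have h2 := convexOn_exp.2 (Set.mem_univ U) (Set.mem_univ W)
    (by norm_num : (0 : ℝ) ≤ 1 / 2) (by norm_num : (0 : ℝ) ≤ 1 / 2) (by norm_num)
  simp only [smul_eq_mul] at h2
  linarith [Real.exp_le_exp.2 h1]

variable [BorelSpace E]

/-- Symmetrisation and contraction in one sample: a centred and reflected absolute value may be
replaced by twice the linear functional itself inside an exponential of a maximum. -/
lemma lintegral_exp_iSup_sub_abs_le [Nonempty ι] {μ : Measure E} [IsProbabilityMeasure μ]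
    (hneg : μ.map (fun x => -x) = μ) (L : ι → StrongDual ℝ E) (hL : ∀ k, Integrable (L k) μ)
    {m : ℝ} (hm : ∀ k, m ≤ ∫ x, |L k x| ∂μ) {c : ℝ} (hc : 0 ≤ c) (a : ι → ℝ) :
    ∫⁻ x, ENNReal.ofReal (Real.exp (⨆ k, (a k + c * (m - |L k x|)))) ∂μ ≤
      ∫⁻ x, ENNReal.ofReal (Real.exp (⨆ k, (a k + 2 * c * L k x))) ∂μ := by
  set Ap : E → ENNReal := fun x => ENNReal.ofReal (Real.exp (⨆ k, (a k + 2 * (c * |L k x|))))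
  set Am : E → ENNReal := fun x => ENNReal.ofReal (Real.exp (⨆ k, (a k - 2 * (c * |L k x|))))
  set B : E → ENNReal := fun x => ENNReal.ofReal (Real.exp (⨆ k, (a k + 2 * c * L k x)))
  have hAp : Measurable Ap :=
    (Measurable.iSup fun k => by fun_prop).exp.ennreal_ofReal
  have hAm : Measurable Am :=
    (Measurable.iSup fun k => by fun_prop).exp.ennreal_ofReal
  have hB : Measurable B :=
    (Measurable.iSup fun k => by fun_prop).exp.ennreal_ofReal
  -- Jensen's inequality in an independent copy `y`, applied to the maximising index
  have h1 : ∀ x, ENNReal.ofReal (Real.exp (⨆ k, (a k + c * (m - |L k x|)))) ≤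
      2⁻¹ * (∫⁻ y, Ap y ∂μ + Am x) := by
    intro x
    obtain ⟨k, hk⟩ := exists_eq_ciSup_of_finite (f := fun k => a k + c * (m - |L k x|))
    rw [← hk]
    have hi' : Integrable (fun y => a k + c * |L k y|) μ :=
      (integrable_const _).add ((hL k).abs.const_mul c)
    have hi : Integrable (fun y => a k + c * |L k y| - c * |L k x|) μ :=
      hi'.sub (integrable_const _)
    calc ENNReal.ofReal (Real.exp (a k + c * (m - |L k x|)))
        ≤ ENNReal.ofReal (Real.exp (∫ y, (a k + c * |L k y| - c * |L k x|) ∂μ)) := by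
          gcongr
          rw [integral_sub hi' (integrable_const _),
            integral_add (integrable_const _) ((hL k).abs.const_mul c), integral_const_mul]
          simp only [integral_const, probReal_univ, one_smul]
          nlinarith [hm k]
      _ ≤ ∫⁻ y, ENNReal.ofReal (Real.exp (a k + c * |L k y| - c * |L k x|)) ∂μ :=
          ofReal_exp_integral_le hi
      _ ≤ ∫⁻ y, 2⁻¹ * (Ap y + Am x) ∂μ := by
          refine lintegral_mono fun y => ?_
          have h2 : (2⁻¹ : ENNReal) = ENNReal.ofReal 2⁻¹ := by
            rw [ENNReal.ofReal_inv_of_pos two_pos]; simp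
          simp only [Ap, Am]
          rw [← ENNReal.ofReal_add (Real.exp_pos _).le (Real.exp_pos _).le, h2,
            ← ENNReal.ofReal_mul (by norm_num)]
          refine ENNReal.ofReal_le_ofReal ?_
          have h3 := exp_iSup_add_sub_le a (fun k => c * |L k y|) (fun k => c * |L k x|)
          have h4 := le_iSup_of_fintype (fun k => a k + c * |L k y| - c * |L k x|) k
          linarith [Real.exp_le_exp.2 h4]
      _ = 2⁻¹ * (∫⁻ y, Ap y ∂μ + Am x) := by
          rw [lintegral_const_mul _ (by fun_prop), lintegral_add_left hAp]
          simp
  have h2 : ∀ x, Ap x + Am x ≤ B x + B (-x) := by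
    intro x
    simp only [Ap, Am, B]
    rw [← ENNReal.ofReal_add (Real.exp_pos _).le (Real.exp_pos _).le,
      ← ENNReal.ofReal_add (Real.exp_pos _).le (Real.exp_pos _).le]
    refine ENNReal.ofReal_le_ofReal ?_
    have h3 := exp_iSup_abs_add_le a fun k => 2 * c * L k x
    simp only [abs_mul, abs_of_nonneg hc, abs_two, mul_assoc] at h3
    simpa only [map_neg, mul_neg, mul_assoc] using h3
  have h3 : ∫⁻ x, B (-x) ∂μ = ∫⁻ x, B x ∂μ := by
    conv_rhs => rw [← hneg, lintegral_map hB measurable_neg]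
  calc _ ≤ ∫⁻ x, 2⁻¹ * (∫⁻ y, Ap y ∂μ + Am x) ∂μ := lintegral_mono h1
    _ = 2⁻¹ * ∫⁻ x, (Ap x + Am x) ∂μ := by
        rw [lintegral_const_mul _ (by fun_prop), lintegral_add_left measurable_const,
          lintegral_add_left hAp]
        simp
    _ ≤ 2⁻¹ * ∫⁻ x, (B x + B (-x)) ∂μ := by
        gcongr 2⁻¹ * ?_
        exact lintegral_mono h2
    _ = ∫⁻ x, B x ∂μ := by
        rw [lintegral_add_left hB, h3, ← two_mul, ← mul_assoc,
          ENNReal.inv_mul_cancel (by norm_num) (by norm_num), one_mul]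

end Symmetrisation

/-- A comparison of integrals that holds for one sample and every additive shift holds for
independent samples, by exchanging the samples one at a time. -/
lemma lintegral_pi_sum_le {M E : Type*} [AddCommMonoid M] [MeasurableSpace M]
    [MeasurableAdd₂ M] [MeasurableSpace E] {μ : Measure E} [IsProbabilityMeasure μ]
    {G : M → ENNReal} (hG : Measurable G) {φ ψ : E → M} (hφ : Measurable φ) (hψ : Measurable ψ)
    (h : ∀ a, ∫⁻ x, G (a + φ x) ∂μ ≤ ∫⁻ x, G (a + ψ x) ∂μ) (n : ℕ) (a : M) :
    ∫⁻ x : Fin n → E, G (a + ∑ i, φ (x i)) ∂(Measure.pi fun _ => μ) ≤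
      ∫⁻ x : Fin n → E, G (a + ∑ i, ψ (x i)) ∂(Measure.pi fun _ => μ) := by
  induction n generalizing a with
  | zero => simp
  | succ n ih =>
    have split : ∀ χ : E → M, Measurable χ →
        ∫⁻ x : Fin (n + 1) → E, G (a + ∑ i, χ (x i)) ∂(Measure.pi fun _ => μ) =
        ∫⁻ z : E × (Fin n → E), G (a + χ z.1 + ∑ i, χ (z.2 i))
          ∂(μ.prod (Measure.pi fun _ => μ)) := by
      intro χ hχ
      have hmp := measurePreserving_piFinSuccAbove (fun _ : Fin (n + 1) => μ) 0
      rw [← hmp.symm.lintegral_comp (by fun_prop)]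
      refine lintegral_congr fun z => ?_
      simp [MeasurableEquiv.piFinSuccAbove_symm_apply, Fin.sum_univ_succ, add_assoc,
        Fin.insertNthEquiv]
    rw [split φ hφ, split ψ hψ, lintegral_prod _ (by fun_prop), lintegral_prod_symm _ (by fun_prop)]
    calc _ ≤ ∫⁻ x, ∫⁻ y : Fin n → E, G (a + φ x + ∑ i, ψ (y i)) ∂(Measure.pi fun _ => μ) ∂μ :=
          lintegral_mono fun x => ih _
      _ = ∫⁻ y : Fin n → E, ∫⁻ x, G (a + ∑ i, ψ (y i) + φ x) ∂μ ∂(Measure.pi fun _ => μ) := by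
          rw [lintegral_lintegral_swap (by fun_prop)]
          simp only [add_right_comm]
      _ ≤ ∫⁻ y : Fin n → E, ∫⁻ x, G (a + ∑ i, ψ (y i) + ψ x) ∂μ ∂(Measure.pi fun _ => μ) :=
          lintegral_mono fun y => h _
      _ = _ := by simp only [add_right_comm]

/-! ### The first absolute moment of a Gaussian variable -/

lemma one_sub_cos_le_abs (t : ℝ) : 1 - Real.cos t ≤ |t| := by
  rcases le_total |t| 2 with h | h
  · nlinarith [Real.one_sub_sq_div_two_le_cos (x := t), sq_abs t, abs_nonneg t]
  · linarith [Real.neg_one_le_cos t]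

/-- The value `3 / 8` is a convenient lower bound for `√(2 / π)`; it comes from `1 - cos t ≤ |t|`
and `E cos Z = exp (-1 / 2)`. -/
lemma three_eighths_le_integral_abs_gaussianReal :
    3 / 8 ≤ ∫ x, |x| ∂(gaussianReal 0 1) := by
  have hcos : ∫ x, Real.cos x ∂(gaussianReal 0 1) = Real.exp (-1 / 2) := by
    have h := congrArg Complex.re (charFun_gaussianReal (μ := 0) (v := 1) 1)
    rw [charFun_apply_real] at h
    have hi : Integrable (fun x : ℝ => Complex.exp ((1 : ℝ) * x * Complex.I))
        (gaussianReal 0 1) := by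
      refine Integrable.of_bound (by fun_prop) 1 (ae_of_all _ fun x => ?_)
      rw [← Complex.ofReal_mul, Complex.norm_exp_ofReal_mul_I]
    have h2 : (∫ x : ℝ, Complex.exp ((1 : ℝ) * x * Complex.I) ∂(gaussianReal 0 1)).re =
        ∫ x : ℝ, (Complex.exp ((1 : ℝ) * x * Complex.I)).re ∂(gaussianReal 0 1) :=
      (integral_re hi).symm
    rw [h2] at h
    simp only [Complex.ofReal_one, one_mul, Complex.exp_ofReal_mul_I_re] at h
    rw [h, ← Complex.exp_ofReal_re]
    congr 2
    push_cast
    ring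
  have hci : Integrable (fun x => 1 - Real.cos x) (gaussianReal 0 1) :=
    Integrable.of_bound (by fun_prop) 2 (ae_of_all _ fun x => by
      rw [Real.norm_eq_abs, abs_le]
      constructor <;> linarith [Real.neg_one_le_cos x, Real.cos_le_one x])
  have habs : Integrable (fun x : ℝ => |x|) (gaussianReal 0 1) :=
    (memLp_one_iff_integrable.1 (memLp_id_gaussianReal 1)).abs
  have h1 : ∫ x, (1 - Real.cos x) ∂(gaussianReal 0 1) ≤ ∫ x, |x| ∂(gaussianReal 0 1) :=
    integral_mono hci habs one_sub_cos_le_abs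
  have hcosi : Integrable (fun x => Real.cos x) (gaussianReal 0 1) :=
    Integrable.of_bound (by fun_prop) 1 (ae_of_all _ fun x => Real.abs_cos_le_one x)
  rw [integral_sub (integrable_const 1) hcosi, hcos] at h1
  simp only [integral_const, probReal_univ, one_smul] at h1
  have h2 : Real.exp (-1 / 2) ≤ 5 / 8 := by
    rw [neg_div, Real.exp_neg]
    have h3 := Real.quadratic_le_exp_of_nonneg (x := 1 / 2) (by norm_num)
    rw [inv_le_comm₀ (Real.exp_pos _) (by norm_num)]
    linarith
  linarith

/-! ### The lower tail of an empirical mean of absolute values -/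

section Tail

variable {E : Type*} [NormedAddCommGroup E] [NormedSpace ℝ E]

/-- The functional `x ↦ ∑ i, L (x i)` on `n`-tuples. -/
def sumDual (n : ℕ) (L : StrongDual ℝ E) : StrongDual ℝ (Fin n → E) :=
  ∑ i, L.comp (ContinuousLinearMap.proj i)

lemma sumDual_apply (n : ℕ) (L : StrongDual ℝ E) (x : Fin n → E) :
    sumDual n L x = ∑ i, L (x i) := by
  simp [sumDual]

variable [MeasurableSpace E] [BorelSpace E]

lemma variance_sumDual (μ : Measure E) [IsGaussian μ] (n : ℕ) (L : StrongDual ℝ E) :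
    Var[sumDual n L; Measure.pi fun _ => μ] = n * Var[L; μ] := by
  have h := variance_sum_pi (μ := fun _ : Fin n => μ) (X := fun _ => L)
    fun _ => IsGaussian.memLp_dual μ L 2 (by norm_num)
  have e : (⇑(sumDual n L) : (Fin n → E) → ℝ) = ∑ i, fun ω : Fin n → E => L (ω i) := by
    ext x; simp [sumDual_apply]
  rw [e, h]
  simp

variable [SecondCountableTopology E] [CompleteSpace E]

lemma map_neg_of_centered (μ : Measure E) [IsGaussian μ] (hμ : ∫ x, x ∂μ = 0) :
    μ.map (fun x => -x) = μ := by
  refine Measure.ext_of_charFunDual ?_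
  ext L
  have h0 : ∫ x, id x ∂μ = 0 := by simpa using hμ
  have h1 : charFunDual (μ.map fun x => -x) L = charFunDual μ (-L) := by
    rw [charFunDual_apply, charFunDual_apply, integral_map (by fun_prop) (by fun_prop)]
    simp
  rw [h1, IsGaussian.charFunDual_eq_of_integral_eq_zero h0,
    IsGaussian.charFunDual_eq_of_integral_eq_zero h0]
  have : Var[⇑(-L); μ] = Var[⇑L; μ] := variance_neg
  rw [this]

lemma isGaussian_pi (μ : Measure E) [IsGaussian μ] (n : ℕ) :
    IsGaussian (Measure.pi fun _ : Fin n => μ) := by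
  have hind : iIndepFun (fun (i : Fin n) (x : Fin n → E) => x i) (Measure.pi fun _ => μ) :=
    iIndepFun_pi (X := fun _ => id) fun _ => aemeasurable_id
  have hg : ∀ i : Fin n, HasGaussianLaw (fun x : Fin n → E => x i) (Measure.pi fun _ => μ) :=
    fun i => ⟨by
      rw [show (fun x : Fin n → E => x i) = Function.eval i from rfl,
        (measurePreserving_eval (fun _ : Fin n => μ) i).map_eq]
      infer_instance⟩
  simpa using (hind.hasGaussianLaw hg).isGaussian_map

lemma integral_id_pi_eq_zero (μ : Measure E) [IsGaussian μ] (hμ : ∫ x, x ∂μ = 0) (n : ℕ) :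
    ∫ x, x ∂(Measure.pi fun _ : Fin n => μ) = 0 := by
  have := isGaussian_pi μ n
  ext i
  have h1 := (ContinuousLinearMap.proj (R := ℝ) (φ := fun _ : Fin n => E) i).integral_comp_comm
    (IsGaussian.integrable_id (μ := Measure.pi fun _ : Fin n => μ))
  simp only [ContinuousLinearMap.proj_apply, id] at h1
  have hmp := measurePreserving_eval (fun _ : Fin n => μ) i
  have h2 : ∫ x : E, x ∂((Measure.pi fun _ : Fin n => μ).map (Function.eval i)) =
      ∫ x : Fin n → E, x i ∂(Measure.pi fun _ : Fin n => μ) :=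
    integral_map hmp.measurable.aemeasurable (by fun_prop)
  rw [← h1, Pi.zero_apply, ← hμ, ← h2, hmp.map_eq]

lemma three_eighths_le_integral_abs_dual (μ : Measure E) [IsGaussian μ] (hμ : ∫ x, x ∂μ = 0)
    (L : StrongDual ℝ E) (hL : Var[L; μ] = 1) : 3 / 8 ≤ ∫ x, |L x| ∂μ := by
  have h := map_dual_of_centered μ hμ L
  rw [hL, Real.toNNReal_one] at h
  have := three_eighths_le_integral_abs_gaussianReal
  rwa [← h, integral_map (by fun_prop) (by fun_prop)] at this

/-- If the penalty `b` dominates the linear process `2 n⁻¹ ∑ i, L k (x i)` with probability at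
least one half, then the penalised mean of `|L k (x i)|` is bounded below uniformly in `k`, except
with exponentially small probability. The exponent comes from Chernoff's bound at the parameter
`n / 100`: it is at most `n * (π ^ 2 / 20000 - (3 / 8 - 1 / 4) / 100)`. -/
theorem measure_exists_mean_abs_add_lt_le {ι : Type*} [Fintype ι] [Nonempty ι] (μ : Measure E)
    [IsGaussian μ] (hμ : ∫ x, x ∂μ = 0) (n : ℕ) (L : ι → StrongDual ℝ E)
    (hL : ∀ k, Var[L k; μ] = 1) (b : ι → ℝ)
    (hb : 1 / 2 ≤ (Measure.pi fun _ : Fin n => μ) {x | ∀ k, 2 * ∑ i, L k (x i) ≤ n * b k}) :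
    (Measure.pi fun _ : Fin n => μ) {x | ∃ k, ∑ i, |L k (x i)| + n * b k < n * (1 / 4)} ≤
      ENNReal.ofReal (2 * Real.exp 1 * Real.exp (-(1 / 2000) * n)) := by
  set ν := Measure.pi fun _ : Fin n => μ with hν
  have hνG : IsGaussian ν := isGaussian_pi μ n
  have hν0 : ∫ x, x ∂ν = 0 := integral_id_pi_eq_zero μ hμ n
  set a : ι → ℝ := fun k => -(1 / 100) * (n * b k) with ha
  set φ : E → ι → ℝ := fun x k => 1 / 100 * (3 / 8 - |L k x|) with hφ
  set ψ : E → ι → ℝ := fun x k => 2 * (1 / 100) * L k x with hψ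
  set G : (ι → ℝ) → ENNReal := fun y => ENNReal.ofReal (Real.exp (⨆ k, y k)) with hG
  have hGm : Measurable G := (Measurable.iSup fun k => measurable_pi_apply k).exp.ennreal_ofReal
  have hφm : Measurable φ := measurable_pi_lambda _ fun k => by fun_prop
  have hψm : Measurable ψ := measurable_pi_lambda _ fun k => by fun_prop
  have hcomp : ∫⁻ x, G (a + ∑ i, φ (x i)) ∂ν ≤ ∫⁻ x, G (a + ∑ i, ψ (x i)) ∂ν :=
    lintegral_pi_sum_le hGm hφm hψm (fun a => lintegral_exp_iSup_sub_abs_le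
      (map_neg_of_centered μ hμ) L (fun k => IsGaussian.integrable_dual μ (L k))
      (fun k => three_eighths_le_integral_abs_dual μ hμ (L k) (hL k)) (by norm_num) a) n a
  have hconc := lintegral_exp_iSup_mul_measure_le ν hν0
    (fun k => (2 * (1 / 100) : ℝ) • sumDual n (L k)) a (s := (1 / 2500) * n) (fun k => by
      have : Var[⇑((2 * (1 / 100) : ℝ) • sumDual n (L k)); ν] =
          (2 * (1 / 100)) ^ 2 * Var[sumDual n (L k); ν] := variance_const_mul _ _ _
      rw [this, variance_sumDual, hL]
      apply le_of_eq
      ring)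
  have hset : {x : Fin n → E | ∀ k, ((2 * (1 / 100) : ℝ) • sumDual n (L k)) x + a k ≤ 0} =
      {x | ∀ k, 2 * ∑ i, L k (x i) ≤ n * b k} := by
    ext x
    refine forall_congr' fun k => ?_
    simp only [smul_apply, sumDual_apply, smul_eq_mul, ha]
    constructor <;> intro h <;> linarith
  have hint : ∫⁻ x, ENNReal.ofReal (Real.exp
      (⨆ k, (((2 * (1 / 100) : ℝ) • sumDual n (L k)) x + a k))) ∂ν =
      ∫⁻ x, G (a + ∑ i, ψ (x i)) ∂ν := by
    refine lintegral_congr fun x => ?_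
    simp only [hG, hψ, smul_apply, sumDual_apply, smul_eq_mul, Pi.add_apply,
      Finset.sum_apply, ← Finset.mul_sum, add_comm]
  rw [hset, hint] at hconc
  have hGφ : Measurable fun x : Fin n → E => G (a + ∑ i, φ (x i)) := hGm.comp (by fun_prop)
  set T := ENNReal.ofReal (Real.exp (1 / 100 * (n * (1 / 8)))) with hT
  have hmarkov : T * ν {x | ∃ k, ∑ i, |L k (x i)| + n * b k < n * (1 / 4)} ≤
      ∫⁻ x, G (a + ∑ i, φ (x i)) ∂ν := by
    refine le_trans ?_ (mul_meas_ge_le_lintegral₀ hGφ.aemeasurable T)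
    gcongr
    intro hk
    obtain ⟨k, hk⟩ := hk
    simp only [hG, hT]
    refine ENNReal.ofReal_le_ofReal (Real.exp_le_exp.2 (le_trans ?_
      (le_iSup_of_fintype _ k)))
    simp only [Pi.add_apply, Finset.sum_apply, ha, hφ, ← Finset.mul_sum, Finset.sum_sub_distrib,
      Finset.sum_const, Finset.card_univ, Fintype.card_fin, nsmul_eq_mul]
    linarith
  have hT0 : T ≠ 0 := by simp [hT, Real.exp_pos]
  have hall : T * ν {x | ∃ k, ∑ i, |L k (x i)| + n * b k < n * (1 / 4)} * (1 / 2) ≤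
      ENNReal.ofReal (Real.exp (1 + Real.pi ^ 2 * (1 / 2500 * n) / 8)) :=
    (mul_le_mul' (hmarkov.trans hcomp) hb).trans hconc
  have hexp : Real.exp (1 + Real.pi ^ 2 * (1 / 2500 * n) / 8) ≤
      Real.exp (1 / 100 * (n * (1 / 8))) * (Real.exp 1 * Real.exp (-(1 / 2000) * n)) := by
    rw [← Real.exp_add, ← Real.exp_add]
    have hpi : Real.pi ^ 2 ≤ 10 := by
      nlinarith [Real.pi_lt_d2, Real.pi_pos]
    have hn : (0 : ℝ) ≤ n := Nat.cast_nonneg n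
    refine Real.exp_le_exp.2 ?_
    nlinarith [mul_le_mul_of_nonneg_right hpi hn]
  have h2 : T * (ν {x | ∃ k, ∑ i, |L k (x i)| + n * b k < n * (1 / 4)} * (1 / 2)) ≤
      T * ENNReal.ofReal (Real.exp 1 * Real.exp (-(1 / 2000) * n)) := by
    rw [← mul_assoc, hT, ← ENNReal.ofReal_mul (Real.exp_pos _).le, ← hT]
    exact hall.trans (ENNReal.ofReal_le_ofReal hexp)
  have h3 := (ENNReal.mul_le_mul_iff_right hT0 ENNReal.ofReal_ne_top).1 h2
  rw [mul_assoc, ENNReal.ofReal_mul two_pos.le, ENNReal.ofReal_ofNat]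
  refine le_trans (le_of_eq ?_) (mul_le_mul_right h3 2)
  have h4 : (2 : ENNReal) * (1 / 2) = 1 := by
    rw [one_div, ENNReal.mul_inv_cancel (by norm_num) (by norm_num)]
  rw [mul_left_comm, h4, mul_one]

end Tail

/-! ### Euclidean norms, the largest eigenvalue, and the square root -/

section Vectors

variable {ι : Type*} [Fintype ι]

lemma l2Norm_nonneg (x : ι → ℝ) : 0 ≤ l2Norm x := norm_nonneg _

lemma l2Norm_sq (x : ι → ℝ) : l2Norm x ^ 2 = x ⬝ᵥ x := by
  rw [l2Norm, EuclideanSpace.real_norm_sq_eq]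
  simp [dotProduct, sq]

lemma l2Norm_smul (c : ℝ) (x : ι → ℝ) : l2Norm (c • x) = |c| * l2Norm x := by
  rw [l2Norm, WithLp.toLp_smul, norm_smul, Real.norm_eq_abs, l2Norm]

lemma l1Norm_smul (c : ℝ) (x : ι → ℝ) : l1Norm (c • x) = |c| * l1Norm x := by
  simp [l1Norm, abs_mul, Finset.mul_sum]

lemma continuous_l2Norm : Continuous (l2Norm : (ι → ℝ) → ℝ) := by
  unfold l2Norm
  exact continuous_norm.comp (PiLp.continuous_toLp 2 _)

lemma continuous_l1Norm : Continuous (l1Norm : (ι → ℝ) → ℝ) := by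
  unfold l1Norm; fun_prop

lemma dotProduct_le_l2Norm_mul (x y : ι → ℝ) : x ⬝ᵥ y ≤ l2Norm x * l2Norm y := by
  have h := real_inner_le_norm (WithLp.toLp 2 y) (WithLp.toLp 2 x)
  rw [EuclideanSpace.inner_toLp_toLp] at h
  simpa [l2Norm, mul_comm] using h

lemma dotProduct_le_mul_l1Norm {x : ι → ℝ} {t : ℝ} (hx : ∀ i, |x i| ≤ t) (y : ι → ℝ) :
    x ⬝ᵥ y ≤ t * l1Norm y := by
  rw [l1Norm, Finset.mul_sum]
  refine Finset.sum_le_sum fun i _ => ?_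
  calc x i * y i ≤ |x i * y i| := le_abs_self _
    _ = |x i| * |y i| := abs_mul _ _
    _ ≤ t * |y i| := by gcongr; exact hx i

/-- The mean of absolute values is at most the quadratic mean. -/
lemma l1Norm_div_le {n : ℕ} (hn : 0 < n) (y : Fin n → ℝ) :
    l1Norm y / n ≤ l2Norm y / √n := by
  have hn' : (0 : ℝ) < n := by exact_mod_cast hn
  have h : l1Norm y ≤ l2Norm y * √n := by
    have h1 : (l1Norm y) ^ 2 ≤ n * l2Norm y ^ 2 := by
      have := sq_sum_le_card_mul_sum_sq (s := Finset.univ) (f := fun i => |y i|)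
      rw [l2Norm_sq]
      simpa [l1Norm, dotProduct, sq_abs, sq] using this
    refine abs_le_of_sq_le_sq' ?_ (by have := l2Norm_nonneg y; positivity) |>.2
    rw [mul_pow, Real.sq_sqrt hn'.le]
    linarith
  rw [div_le_div_iff₀ hn' (by positivity)]
  calc l1Norm y * √n ≤ l2Norm y * √n * √n := by gcongr
    _ = l2Norm y * n := by rw [mul_assoc, Real.mul_self_sqrt hn'.le]

variable [DecidableEq ι] {S : Matrix ι ι ℝ}

lemma dotProduct_mulVec_le_maxEigenvalue (hS : S.PosSemidef) (x : ι → ℝ) :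
    x ⬝ᵥ S *ᵥ x ≤ maxEigenvalue S * (x ⬝ᵥ x) := by
  have hfin : (spectrum ℝ S).Finite := by
    rw [hS.isHermitian.spectrum_real_eq_range_eigenvalues]; exact Set.finite_range _
  have h : S ≤ algebraMap ℝ (Matrix ι ι ℝ) (maxEigenvalue S) :=
    le_algebraMap_of_spectrum_le (fun r hr => le_csSup hfin.bddAbove hr)
      (ha := hS.isHermitian)
  have h2 := (Matrix.le_iff.1 h).dotProduct_mulVec_nonneg x
  rw [Algebra.algebraMap_eq_smul_one, Matrix.sub_mulVec, Matrix.smul_mulVec, Matrix.one_mulVec,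
    dotProduct_sub, dotProduct_smul] at h2
  simpa using h2

lemma l2Norm_sqrt_mulVec_sq (hS : S.PosSemidef) (x : ι → ℝ) :
    l2Norm (CFC.sqrt S *ᵥ x) ^ 2 = x ⬝ᵥ S *ᵥ x := by
  have hT : (CFC.sqrt S)ᵀ = CFC.sqrt S := by
    have := (CFC.sqrt_nonneg S).isSelfAdjoint
    simpa [IsSelfAdjoint, Matrix.star_eq_conjTranspose] using this
  rw [l2Norm_sq, Matrix.dotProduct_mulVec, Matrix.vecMul_mulVec, ← Matrix.dotProduct_mulVec, hT,
    CFC.sqrt_mul_sqrt_self S hS.nonneg]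

end Vectors

/-! ### The incidence matrix and its Moore–Penrose inverse -/

section Incidence

/-- The orthogonal projection `1 - A⁺ A` onto the kernel of `A`. -/
noncomputable def kerProj {ι κ : Type*} [Fintype ι] [Fintype κ] [DecidableEq κ]
    (A : Matrix ι κ ℝ) : Matrix κ κ ℝ := 1 - pinv A * A

variable {ι κ : Type*} [Fintype ι] [Fintype κ]

lemma l2Norm_col_pinv_le (A : Matrix ι κ ℝ) (j : ι) :
    l2Norm (fun k => pinv A k j) ≤ invScaling A :=
  le_ciSup (f := fun j => l2Norm fun k => pinv A k j) (Set.finite_range _).bddAbove j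

lemma invScaling_pos {A : Matrix ι κ ℝ} (hA : A ≠ 0) : 0 < invScaling A := by
  by_contra! hle
  have hB : pinv A = 0 := by
    ext k j
    have h0 : l2Norm (fun k => pinv A k j) = 0 :=
      le_antisymm ((l2Norm_col_pinv_le A j).trans hle) (l2Norm_nonneg _)
    rw [l2Norm, norm_eq_zero, WithLp.toLp_eq_zero] at h0
    exact congrFun h0 k
  have := (isMoorePenrose_pinv A).mul_mul_self
  rw [hB] at this
  exact hA (by simpa using this.symm)

variable [DecidableEq κ]

lemma kerProj_mul_self (A : Matrix ι κ ℝ) : kerProj A * kerProj A = kerProj A := by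
  have h : pinv A * A * (pinv A * A) = pinv A * A := by
    rw [← Matrix.mul_assoc, (isMoorePenrose_pinv A).mul_mul_inv]
  simp [kerProj, Matrix.mul_sub, Matrix.sub_mul, h]

lemma kerProj_transpose (A : Matrix ι κ ℝ) : (kerProj A)ᵀ = kerProj A := by
  rw [kerProj, Matrix.transpose_sub, (isMoorePenrose_pinv A).symm_inv_mul, Matrix.transpose_one]

/-- The trace of the kernel projection is the dimension of the kernel. -/
lemma trace_kerProj (A : Matrix ι κ ℝ) :
    (kerProj A).trace = Module.finrank ℝ (Matrix.toLin' A).ker := by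
  have h : LinearMap.IsProj (Matrix.toLin' A).ker (Matrix.toLin' (kerProj A)) := by
    constructor
    · intro x
      rw [LinearMap.mem_ker, Matrix.toLin'_apply, Matrix.toLin'_apply, Matrix.mulVec_mulVec,
        kerProj, Matrix.mul_sub, ← Matrix.mul_assoc, (isMoorePenrose_pinv A).mul_mul_self]
      simp
    · intro x hx
      rw [LinearMap.mem_ker, Matrix.toLin'_apply] at hx
      rw [Matrix.toLin'_apply, kerProj, Matrix.sub_mulVec, ← Matrix.mulVec_mulVec, hx]
      simp
  rw [← h.trace, Matrix.trace_toLin'_eq]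

lemma sum_dotProduct_kerProj (A : Matrix ι κ ℝ) :
    ∑ k, kerProj A k ⬝ᵥ kerProj A k = (kerProj A).trace := by
  conv_rhs => rw [← kerProj_mul_self]
  refine Finset.sum_congr rfl fun k _ => ?_
  rw [Matrix.diag_apply, Matrix.mul_apply']
  exact congrArg _ (funext fun j => (congrFun (congrFun (kerProj_transpose A) k) j).symm)

/-- The splitting of an inner product along the kernel of `A` and its orthogonal complement. -/
lemma dotProduct_eq_kerProj_add (A : Matrix ι κ ℝ) (h v : κ → ℝ) :
    h ⬝ᵥ v = (kerProj A *ᵥ h) ⬝ᵥ v + (h ᵥ* pinv A) ⬝ᵥ (A *ᵥ v) := by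
  have h1 : kerProj A *ᵥ h = h ᵥ* kerProj A := by
    rw [← Matrix.mulVec_transpose, kerProj_transpose]
  rw [h1, ← Matrix.dotProduct_mulVec, ← Matrix.dotProduct_mulVec, Matrix.mulVec_mulVec,
    ← dotProduct_add, ← Matrix.add_mulVec]
  simp [kerProj]

end Incidence

section Graph

variable {p : ℕ} (G : SimpleGraph (Fin p))

lemma incidence_mulVec (x : Fin p → ℝ) (e : G.edgeSet) :
    (incidence G *ᵥ x) e = x e.1.inf - x e.1.sup := by
  have hne : e.1.sup ≠ e.1.inf := by
    obtain ⟨e, he⟩ := e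
    induction e with
    | h a b =>
      have hab : a ≠ b := G.ne_of_adj he
      simpa using hab
  have h1 : ∀ k, incidence G e k * x k =
      (if k = e.1.inf then x k else 0) - if k = e.1.sup then x k else 0 := by
    intro k
    simp only [incidence, Matrix.of_apply]
    by_cases h : k = e.1.inf
    · simp [h, hne.symm]
    · by_cases h' : k = e.1.sup <;> simp [h', h, hne]
  simp [Matrix.mulVec, dotProduct, h1, Finset.sum_sub_distrib]

lemma incidence_mulVec_eq_zero_iff (x : Fin p → ℝ) :
    incidence G *ᵥ x = 0 ↔ ∀ i j, G.Adj i j → x i = x j := by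
  constructor
  · intro h i j hij
    have := congrFun h ⟨s(i, j), hij⟩
    rw [incidence_mulVec] at this
    simp only [Sym2.inf_mk, Sym2.sup_mk, Pi.zero_apply] at this
    rcases le_total i j with hle | hle
    · rw [inf_eq_left.2 hle, sup_eq_right.2 hle] at this; linarith
    · rw [inf_eq_right.2 hle, sup_eq_left.2 hle] at this; linarith
  · intro h
    ext ⟨e, he⟩
    rw [incidence_mulVec]
    induction e with
    | h a b =>
      simp only [Sym2.inf_mk, Sym2.sup_mk, Pi.zero_apply]
      have hab := h a b he
      rcases le_total a b with hle | hle
      · rw [inf_eq_left.2 hle, sup_eq_right.2 hle]; linarith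
      · rw [inf_eq_right.2 hle, sup_eq_left.2 hle]; linarith

lemma trace_kerProj_incidence [DecidableRel G.Adj] :
    (kerProj (incidence G)).trace = Nat.card G.ConnectedComponent := by
  classical
  have hker : (Matrix.toLin' (incidence G)).ker = (G.lapMatrix ℝ).toLin'.ker := by
    ext x
    rw [LinearMap.mem_ker, LinearMap.mem_ker, Matrix.toLin'_apply, Matrix.toLin'_apply,
      incidence_mulVec_eq_zero_iff, G.lapMatrix_mulVec_eq_zero_iff_forall_adj]
  rw [trace_kerProj, hker, ← G.card_connectedComponent_eq_finrank_ker_toLin'_lapMatrix,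
    Nat.card_eq_fintype_card]

lemma incidence_ne_zero [DecidableRel G.Adj] (hG : 0 < G.edgeFinset.card) : incidence G ≠ 0 := by
  obtain ⟨e, he⟩ := Finset.card_pos.1 hG
  rw [SimpleGraph.mem_edgeFinset] at he
  intro h
  have := congrFun (congrFun h ⟨e, he⟩) e.inf
  simp [incidence] at this

lemma two_mul_card_edgeFinset_le [DecidableRel G.Adj] : 2 * G.edgeFinset.card ≤ p ^ 2 := by
  have h := G.card_edgeFinset_le_card_choose_two
  rw [Fintype.card_fin, Nat.choose_two_right] at h
  have h2 : p * (p - 1) ≤ p ^ 2 := by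
    rw [sq]; exact Nat.mul_le_mul_left _ (Nat.sub_le _ _)
  omega

end Graph

/-! ### The linear process is dominated by the penalty with probability at least one half -/

section GaussianTails

variable {E : Type*} [NormedAddCommGroup E] [NormedSpace ℝ E] [MeasurableSpace E] [BorelSpace E]
  [SecondCountableTopology E] [CompleteSpace E]

lemma hasSubgaussianMGF_dual (ν : Measure E) [IsGaussian ν] (hν : ∫ x, x ∂ν = 0)
    (L : StrongDual ℝ E) {V : NNReal} (hV : Var[L; ν] ≤ V) : HasSubgaussianMGF L V ν where
  integrable_exp_mul t := by
    have := integrable_exp_mul_gaussianReal (μ := 0) (v := (Var[L; ν]).toNNReal) t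
    rw [← map_dual_of_centered ν hν L, integrable_map_measure (by fun_prop) (by fun_prop)] at this
    exact this
  mgf_le t := by
    rw [mgf_gaussianReal (map_dual_of_centered ν hν L), Real.coe_toNNReal _ (variance_nonneg _ _),
      zero_mul, zero_add]
    gcongr

lemma measureReal_le_abs_dual_le (ν : Measure E) [IsGaussian ν] (hν : ∫ x, x ∂ν = 0)
    (L : StrongDual ℝ E) {V : ℝ} (hV : Var[L; ν] ≤ V) {t : ℝ} (ht : 0 ≤ t) :
    ν.real {x | t ≤ |L x|} ≤ 2 * Real.exp (-t ^ 2 / (2 * V)) := by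
  lift V to NNReal using (variance_nonneg _ _).trans hV
  have h1 := (hasSubgaussianMGF_dual ν hν L hV).measure_ge_le ht
  have h2 := (hasSubgaussianMGF_dual ν hν L hV).neg.measure_ge_le ht
  calc ν.real {x | t ≤ |L x|} ≤ ν.real ({x | t ≤ L x} ∪ {x | t ≤ (-⇑L) x}) :=
        measureReal_mono fun x hx => by
          simp only [Set.mem_union, Set.mem_ofPred_eq, Pi.neg_apply] at hx ⊢
          exact le_abs.1 hx
    _ ≤ _ := measureReal_union_le _ _
    _ ≤ _ := by linarith

lemma integral_sq_dual (ν : Measure E) [IsGaussian ν] (hν : ∫ x, x ∂ν = 0)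
    (L : StrongDual ℝ E) : ∫ x, L x ^ 2 ∂ν = Var[L; ν] := by
  rw [variance_of_integral_eq_zero (by fun_prop)]
  rw [IsGaussian.integral_dual, hν, map_zero]

lemma measureReal_le_sum_sq_dual_le {κ : Type*} [Fintype κ] (ν : Measure E) [IsGaussian ν]
    (hν : ∫ x, x ∂ν = 0) (M : κ → StrongDual ℝ E) {ε : ℝ} (hε : 0 < ε) :
    ν.real {x | ε ≤ ∑ k, M k x ^ 2} ≤ (∑ k, Var[M k; ν]) / ε := by
  have hi : ∀ k, Integrable (fun x => M k x ^ 2) ν := fun k =>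
    (IsGaussian.memLp_dual ν (M k) 2 (by norm_num)).integrable_sq
  have h := mul_meas_ge_le_integral_of_nonneg (μ := ν) (f := fun x => ∑ k, M k x ^ 2)
    (ae_of_all _ fun x => by positivity) (integrable_finsetSum _ fun k _ => hi k) ε
  rw [integral_finsetSum _ fun k _ => hi k] at h
  simp_rw [integral_sq_dual ν hν] at h
  rw [le_div_iff₀ hε, mul_comm]
  exact h

end GaussianTails

section Penalty

variable {p : ℕ}

/-- The functional `x ↦ ⟨w, x⟩` on Euclidean space. -/
noncomputable def dualOf (w : Fin p → ℝ) : StrongDual ℝ (EuclideanSpace ℝ (Fin p)) :=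
  innerSL ℝ (WithLp.toLp 2 w)

lemma dualOf_apply (w : Fin p → ℝ) (x : EuclideanSpace ℝ (Fin p)) :
    dualOf w x = WithLp.ofLp x ⬝ᵥ w := by
  simp [dualOf, PiLp.inner_apply, dotProduct]

lemma variance_dualOf {S : Matrix (Fin p) (Fin p) ℝ} (hS : S.PosSemidef) (w : Fin p → ℝ) :
    Var[dualOf w; multivariateGaussian 0 S] = w ⬝ᵥ S *ᵥ w := by
  have h := covarianceBilin_multivariateGaussian (μ := 0) hS (WithLp.toLp 2 w) (WithLp.toLp 2 w)
  rw [covarianceBilin_self IsGaussian.memLp_two_id] at h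
  exact h

/-- Splitting `h = ∑ i, x i` along the kernel of `A = incidence G` and its complement, the process
`⟨h, v⟩` is at most `‖Π h‖₂ ‖v‖₂ + maxⱼ |⟨h, sⱼ⟩| ‖A v‖₁`, where `Π = kerProj A` and `sⱼ` are
the columns of `pinv A`. The first factor is controlled by
its second moment (failure probability `4 / 9`), the second by a union bound over the edges
(failure probability `2 m p ^ (-9) ≤ 1 / 128`). -/
theorem half_le_measure_process_le {n : ℕ} (hn : 0 < n) (G : SimpleGraph (Fin p))
    [DecidableRel G.Adj] (hG : 2 ≤ G.edgeFinset.card) {S : Matrix (Fin p) (Fin p) ℝ}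
    (hS : S.PosSemidef) (hγ : 0 < maxEigenvalue S) :
    1 / 2 ≤ (Measure.pi fun _ : Fin n => multivariateGaussian 0 S)
      {x | ∀ v : Fin p → ℝ, 2 * ∑ i, dualOf v (x i) ≤
        n * (3 * √(maxEigenvalue S * Nat.card G.ConnectedComponent / n) * l2Norm v
          + 6 * √2 * invScaling (incidence G) * √(maxEigenvalue S * Real.log p / n)
            * l1Norm (incidence G *ᵥ v))} := by
  set μ := multivariateGaussian 0 S with hμ
  have hμ0 : ∫ x, x ∂μ = 0 := integral_id_multivariateGaussian
  set ν := Measure.pi fun _ : Fin n => μ with hν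
  have hνG : IsGaussian ν := isGaussian_pi μ n
  have hν0 : ∫ x, x ∂ν = 0 := integral_id_pi_eq_zero μ hμ0 n
  set γ := maxEigenvalue S with hγdef
  set A := incidence G with hA
  set ρ := invScaling A with hρdef
  set N : ℝ := (Nat.card G.ConnectedComponent : ℝ) with hN
  have hm := two_mul_card_edgeFinset_le G
  have hp : 2 ≤ p := by nlinarith
  have hpR : (2 : ℝ) ≤ p := by exact_mod_cast hp
  have hn' : (0 : ℝ) < n := by exact_mod_cast hn
  have hN0 : 0 < N := by
    have : Nonempty G.ConnectedComponent := ⟨G.connectedComponentMk ⟨0, by omega⟩⟩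
    rw [hN]
    exact_mod_cast Nat.card_pos
  have hρ : 0 < ρ := invScaling_pos (incidence_ne_zero G (by omega))
  have hlog : 0 < Real.log p := Real.log_pos (by linarith)
  have hvar : ∀ w : Fin p → ℝ, Var[sumDual n (dualOf w); ν] ≤ n * (γ * (w ⬝ᵥ w)) := by
    intro w
    rw [variance_sumDual, variance_dualOf hS]
    gcongr
    exact dotProduct_mulVec_le_maxEigenvalue hS w
  set good : Set (Fin n → EuclideanSpace ℝ (Fin p)) :=
    {x | ∀ v : Fin p → ℝ, 2 * ∑ i, dualOf v (x i) ≤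
        n * (3 * √(γ * N / n) * l2Norm v
          + 6 * √2 * ρ * √(γ * Real.log p / n) * l1Norm (A *ᵥ v))} with hgood
  set t : ℝ := 3 * √2 * ρ * √(γ * Real.log p * n) with ht
  have ht0 : 0 ≤ t := by positivity
  set bad₁ : Set (Fin n → EuclideanSpace ℝ (Fin p)) :=
    {x | 9 / 4 * (n * (γ * N)) ≤ ∑ k, sumDual n (dualOf (kerProj A k)) x ^ 2} with hbad₁
  set bad₂ : Set (Fin n → EuclideanSpace ℝ (Fin p)) :=
    ⋃ j : G.edgeSet, {x | t ≤ |sumDual n (dualOf fun k => pinv A k j) x|} with hbad₂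
  have hP₁ : ν.real bad₁ ≤ 4 / 9 := by
    refine (measureReal_le_sum_sq_dual_le ν hν0 _ (by positivity)).trans ?_
    rw [div_le_iff₀ (by positivity)]
    calc _ ≤ ∑ k, n * (γ * (kerProj A k ⬝ᵥ kerProj A k)) := Finset.sum_le_sum fun k _ => hvar _
      _ = n * (γ * N) := by
          rw [← Finset.mul_sum, ← Finset.mul_sum, sum_dotProduct_kerProj,
            trace_kerProj_incidence]
      _ = _ := by ring
  have hP₂ : ν.real bad₂ ≤ 1 / 128 := by
    have h1 : ∀ j : G.edgeSet,
        ν.real {x | t ≤ |sumDual n (dualOf fun k => pinv A k j) x|} ≤ 2 * ((p : ℝ) ^ 9)⁻¹ := by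
      intro j
      have hv : Var[sumDual n (dualOf fun k => pinv A k j); ν] ≤ n * (γ * ρ ^ 2) := by
        refine (hvar _).trans ?_
        rw [← l2Norm_sq]
        have := l2Norm_col_pinv_le A j
        have := l2Norm_nonneg fun k => pinv A k j
        gcongr
      refine (measureReal_le_abs_dual_le ν hν0 _ hv ht0).trans (le_of_eq ?_)
      have he : -t ^ 2 / (2 * (n * (γ * ρ ^ 2))) = -((9 : ℕ) * Real.log p) := by
        rw [ht, mul_pow, mul_pow, mul_pow, Real.sq_sqrt two_pos.le, Real.sq_sqrt (by positivity)]
        field_simp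
        norm_num
      rw [he, Real.exp_neg, Real.exp_nat_mul, Real.exp_log (by linarith)]
    calc ν.real bad₂ ≤ ∑ j : G.edgeSet, _ := measureReal_iUnion_fintype_le _
      _ ≤ ∑ _j : G.edgeSet, 2 * ((p : ℝ) ^ 9)⁻¹ := Finset.sum_le_sum fun j _ => h1 j
      _ = (2 * G.edgeFinset.card : ℕ) * ((p : ℝ) ^ 9)⁻¹ := by
          rw [Finset.sum_const, Finset.card_univ, ← SimpleGraph.edgeFinset_card, nsmul_eq_mul]
          push_cast
          ring
      _ ≤ (p ^ 2 : ℕ) * ((p : ℝ) ^ 9)⁻¹ := by gcongr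
      _ = ((p : ℝ) ^ 7)⁻¹ := by
          push_cast
          field_simp
      _ ≤ ((2 : ℝ) ^ 7)⁻¹ := by gcongr
      _ = 1 / 128 := by norm_num
  have hcover : (Set.univ : Set (Fin n → EuclideanSpace ℝ (Fin p))) ⊆ good ∪ (bad₁ ∪ bad₂) := by
    intro x _
    by_contra hx
    simp only [Set.mem_union, not_or] at hx
    obtain ⟨hx, hx₁, hx₂⟩ := hx
    refine hx fun v => ?_
    obtain ⟨h, hh⟩ : ∃ h : Fin p → ℝ, h = ∑ i, WithLp.ofLp (x i) := ⟨_, rfl⟩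
    have hsum : ∀ w, sumDual n (dualOf w) x = h ⬝ᵥ w := by
      intro w
      simp only [sumDual_apply, dualOf_apply, hh, sum_dotProduct]
    have hsum' : ∑ i, dualOf v (x i) = h ⬝ᵥ v := by rw [← sumDual_apply, hsum]
    have hk : l2Norm (kerProj A *ᵥ h) ≤ 3 / 2 * √(γ * N * n) := by
      simp only [hbad₁, Set.mem_ofPred_eq, not_le, hsum] at hx₁
      refine abs_le_of_sq_le_sq' ?_ (by positivity) |>.2
      rw [l2Norm_sq, mul_pow, Real.sq_sqrt (by positivity)]
      refine le_trans (le_of_eq ?_) (hx₁.le.trans (le_of_eq (by ring)))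
      refine Finset.sum_congr rfl fun k _ => ?_
      rw [← sq, Matrix.mulVec, dotProduct_comm]
    have hs : ∀ j, |(h ᵥ* pinv A) j| ≤ t := by
      intro j
      simp only [hbad₂, Set.mem_iUnion, Set.mem_ofPred_eq, not_exists, not_le, hsum] at hx₂
      exact (hx₂ j).le
    have hroot : ∀ a : ℝ, 0 ≤ a → √(a * n) = n * √(a / n) := by
      intro a ha
      rw [← Real.sqrt_sq hn'.le, ← Real.sqrt_mul (by positivity), Real.sqrt_sq hn'.le]
      congr 1
      field_simp
    rw [hsum', dotProduct_eq_kerProj_add A h v]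
    have h1 := dotProduct_le_l2Norm_mul (kerProj A *ᵥ h) v
    have h2 := dotProduct_le_mul_l1Norm hs (A *ᵥ v)
    have h3 := mul_le_mul_of_nonneg_right hk (l2Norm_nonneg v)
    rw [ht] at h2
    rw [hroot _ (by positivity)] at h2 h3
    linarith
  have htotal : 1 ≤ ν.real good + (ν.real bad₁ + ν.real bad₂) := by
    calc (1 : ℝ) = ν.real Set.univ := by rw [probReal_univ]
      _ ≤ ν.real (good ∪ (bad₁ ∪ bad₂)) := measureReal_mono hcover
      _ ≤ ν.real good + ν.real (bad₁ ∪ bad₂) := measureReal_union_le _ _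
      _ ≤ _ := by gcongr; exact measureReal_union_le _ _
  have hhalf : (1 / 2 : ENNReal) = ENNReal.ofReal (1 / 2) := by
    rw [ENNReal.ofReal_div_of_pos two_pos]; simp
  rw [hhalf]
  refine ENNReal.ofReal_le_of_le_toReal ?_
  change 1 / 2 ≤ ν.real good
  linarith

end Penalty

/-! ### From finite families to all vectors -/

section Main

variable {n p : ℕ}

/-- The defining inequality of the event for the sample `x` and the vector `v`, with general
factors `α` and `β` of the two penalties. -/
def LowerBoundAt (G : SimpleGraph (Fin p)) [DecidableRel G.Adj]
    (S : Matrix (Fin p) (Fin p) ℝ) (α β : ℝ)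
    (x : Fin n → EuclideanSpace ℝ (Fin p)) (v : Fin p → ℝ) : Prop :=
  (1 / 4) * l2Norm (CFC.sqrt S *ᵥ v) - α * l2Norm v - β * l1Norm (incidence G *ᵥ v) ≤
    l2Norm (fun i => dualOf v (x i)) / √n

variable {G : SimpleGraph (Fin p)} [DecidableRel G.Adj] {S : Matrix (Fin p) (Fin p) ℝ} {α β : ℝ}

lemma isClosed_setOf_lowerBoundAt (v : Fin p → ℝ) :
    IsClosed {x : Fin n → EuclideanSpace ℝ (Fin p) | LowerBoundAt G S α β x v} := by
  refine isClosed_le continuous_const (Continuous.div_const (continuous_l2Norm.comp ?_) _)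
  fun_prop

lemma isClosed_setOf_lowerBoundAt' (x : Fin n → EuclideanSpace ℝ (Fin p)) :
    IsClosed {v : Fin p → ℝ | LowerBoundAt G S α β x v} := by
  have h1 : Continuous fun v : Fin p → ℝ => l2Norm (CFC.sqrt S *ᵥ v) :=
    continuous_l2Norm.comp (by fun_prop)
  have h2 : Continuous fun v : Fin p → ℝ => l1Norm (incidence G *ᵥ v) :=
    continuous_l1Norm.comp (by fun_prop)
  have h3 : Continuous fun v : Fin p → ℝ => l2Norm fun i => dualOf v (x i) := by
    refine continuous_l2Norm.comp (continuous_pi fun i => ?_)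
    simp only [dualOf_apply, dotProduct]
    fun_prop
  refine isClosed_le ?_ (h3.div_const _)
  exact ((h1.const_mul _).sub (continuous_l2Norm.const_mul _)).sub (h2.const_mul _)

lemma dualOf_smul (c : ℝ) (w : Fin p → ℝ) : dualOf (c • w) = c • dualOf w := by
  simp [dualOf]

/-- A violation at `v` is, after scaling `v` to `‖S^{1/2} v‖ = 1`, a violation of the lower bound
for the mean of absolute values. -/
lemma sum_abs_add_lt_of_not_lowerBoundAt (hn : 0 < n) {x : Fin n → EuclideanSpace ℝ (Fin p)}
    {v : Fin p → ℝ} (h : ¬ LowerBoundAt G S α β x v) {s : ℝ}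
    (hs : s = l2Norm (CFC.sqrt S *ᵥ v)) (hs0 : 0 < s) :
    ∑ i, |dualOf (s⁻¹ • v) (x i)| + n * (α * l2Norm (s⁻¹ • v)
      + β * l1Norm (incidence G *ᵥ (s⁻¹ • v))) < n * (1 / 4) := by
  have hn' : (0 : ℝ) < n := by exact_mod_cast hn
  rw [LowerBoundAt, not_le, ← hs] at h
  have h1 := (l1Norm_div_le hn fun i => dualOf v (x i)).trans_lt h
  rw [div_lt_iff₀ hn'] at h1
  have hpos : 0 < s⁻¹ := inv_pos.2 hs0
  simp only [Matrix.mulVec_smul, l2Norm_smul, l1Norm_smul, dualOf_smul, smul_apply, smul_eq_mul,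
    abs_mul, abs_of_pos hpos, ← Finset.mul_sum]
  have h2 := mul_lt_mul_of_pos_left h1 hpos
  rw [l1Norm] at h2
  have h3 : s⁻¹ * s = 1 := inv_mul_cancel₀ hs0.ne'
  calc _ < s⁻¹ * ((1 / 4 * s - α * l2Norm v - β * l1Norm (incidence G *ᵥ v)) * n) +
        n * (α * (s⁻¹ * l2Norm v) + β * (s⁻¹ * l1Norm (incidence G *ᵥ v))) := by gcongr
    _ = (s⁻¹ * s) * (n * (1 / 4)) := by ring
    _ = n * (1 / 4) := by rw [h3, one_mul]

theorem measure_exists_not_lowerBoundAt_le (hn : 0 < n)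
    (hG : 2 ≤ G.edgeFinset.card) (hS : S.PosSemidef) {ι : Type*} [Fintype ι]
    (v : ι → Fin p → ℝ) :
    (Measure.pi fun _ : Fin n => multivariateGaussian 0 S)
      {x | ∃ k, ¬ LowerBoundAt G S (3 * √(maxEigenvalue S * Nat.card G.ConnectedComponent / n))
        (6 * √2 * invScaling (incidence G) * √(maxEigenvalue S * Real.log p / n)) x (v k)} ≤
      ENNReal.ofReal (2 * Real.exp 1 * Real.exp (-(1 / 2000) * n)) := by
  classical
  set γ := maxEigenvalue S with hγ
  set α := 3 * √(γ * Nat.card G.ConnectedComponent / n) with hα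
  set β := 6 * √2 * invScaling (incidence G) * √(γ * Real.log p / n) with hβ
  have hα0 : 0 ≤ α := by positivity
  have hβ0 : 0 ≤ β := by
    have hρ : 0 ≤ invScaling (incidence G) :=
      Real.iSup_nonneg fun j => l2Norm_nonneg _
    positivity
  let s : ι → ℝ := fun k => l2Norm (CFC.sqrt S *ᵥ v k)
  have hbad0 : ∀ (x : Fin n → EuclideanSpace ℝ (Fin p)) k,
      ¬ LowerBoundAt G S α β x (v k) → 0 < s k := by
    intro x k hk
    by_contra! hle
    refine hk ?_
    have h1 : l2Norm (CFC.sqrt S *ᵥ v k) = 0 := le_antisymm hle (l2Norm_nonneg _)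
    rw [LowerBoundAt, h1]
    have h2 := l2Norm_nonneg (v k)
    have h3 : 0 ≤ l1Norm (incidence G *ᵥ v k) := Finset.sum_nonneg fun _ _ => abs_nonneg _
    have h4 : 0 ≤ l2Norm (fun i => dualOf (v k) (x i)) / √n :=
      div_nonneg (l2Norm_nonneg _) (Real.sqrt_nonneg _)
    nlinarith [mul_nonneg hα0 h2, mul_nonneg hβ0 h3]
  rcases isEmpty_or_nonempty {k // 0 < s k} with hι | ⟨⟨k₀, hk₀⟩⟩
  · have : {x : Fin n → EuclideanSpace ℝ (Fin p) | ∃ k, ¬ LowerBoundAt G S α β x (v k)} = ∅ := by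
      ext x
      simp only [Set.mem_ofPred_eq, Set.mem_empty_iff_false, iff_false]
      rintro ⟨k, hk⟩
      exact hι.false ⟨k, hbad0 x k hk⟩
    rw [this, measure_empty]
    exact zero_le
  have hne : Nonempty {k // 0 < s k} := ⟨⟨k₀, hk₀⟩⟩
  have hγ0 : 0 < γ := by
    have h1 := dotProduct_mulVec_le_maxEigenvalue hS (v k₀)
    rw [← l2Norm_sqrt_mulVec_sq hS, ← l2Norm_sq] at h1
    have h2 : 0 < l2Norm (CFC.sqrt S *ᵥ v k₀) ^ 2 := pow_pos hk₀ 2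
    exact pos_of_mul_pos_left (h2.trans_le h1) (sq_nonneg _)
  let w : {k // 0 < s k} → Fin p → ℝ := fun k => (s k)⁻¹ • v k
  have hvar : ∀ k, Var[dualOf (w k); multivariateGaussian 0 S] = 1 := by
    intro k
    rw [variance_dualOf hS, ← l2Norm_sqrt_mulVec_sq hS, Matrix.mulVec_smul, l2Norm_smul,
      abs_of_pos (inv_pos.2 k.2)]
    change ((s k)⁻¹ * s k) ^ 2 = 1
    rw [inv_mul_cancel₀ k.2.ne', one_pow]
  refine le_trans (measure_mono ?_) (measure_exists_mean_abs_add_lt_le (multivariateGaussian 0 S)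
    integral_id_multivariateGaussian n (fun k => dualOf (w k)) hvar
    (fun k => α * l2Norm (w k) + β * l1Norm (incidence G *ᵥ w k)) ?_)
  · rintro x ⟨k, hk⟩
    exact ⟨⟨k, hbad0 x k hk⟩, sum_abs_add_lt_of_not_lowerBoundAt hn hk rfl (hbad0 x k hk)⟩
  · refine (half_le_measure_process_le hn G hG hS hγ0).trans (measure_mono ?_)
    intro x hx k
    exact hx (w k)

/-- By continuity it suffices to control a dense sequence of vectors, and its finite initial
segments exhaust the violations monotonically. -/
theorem measure_not_forall_lowerBoundAt_le (hn : 0 < n)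
    (hG : 2 ≤ G.edgeFinset.card) (hS : S.PosSemidef) :
    (Measure.pi fun _ : Fin n => multivariateGaussian 0 S)
      {x | ∀ v, LowerBoundAt G S (3 * √(maxEigenvalue S * Nat.card G.ConnectedComponent / n))
        (6 * √2 * invScaling (incidence G) * √(maxEigenvalue S * Real.log p / n)) x v}ᶜ ≤
      ENNReal.ofReal (2 * Real.exp 1 * Real.exp (-(1 / 2000) * n)) := by
  set α := 3 * √(maxEigenvalue S * Nat.card G.ConnectedComponent / n) with hα
  set β := 6 * √2 * invScaling (incidence G) * √(maxEigenvalue S * Real.log p / n) with hβ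
  let d := TopologicalSpace.denseSeq (Fin p → ℝ)
  let T : ℕ → Set (Fin n → EuclideanSpace ℝ (Fin p)) :=
    fun N => {x | ∃ k : Fin N, ¬ LowerBoundAt G S α β x (d k)}
  have hT : Monotone T := fun N M hNM x ⟨k, hk⟩ => ⟨Fin.castLE hNM k, hk⟩
  have hsub : {x : Fin n → EuclideanSpace ℝ (Fin p) | ∀ v, LowerBoundAt G S α β x v}ᶜ ⊆
      ⋃ N, T N := by
    intro x hx
    by_contra hx'
    refine hx fun v => ?_
    have hall : ∀ k, LowerBoundAt G S α β x (d k) := by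
      intro k
      by_contra hk
      exact hx' (Set.mem_iUnion.2 ⟨k + 1, ⟨k, Nat.lt_succ_self k⟩, hk⟩)
    have hcl := (isClosed_setOf_lowerBoundAt' (G := G) (S := S) (α := α) (β := β) x)
    have hd : closure (Set.range d) ⊆ {v | LowerBoundAt G S α β x v} :=
      hcl.closure_subset_iff.2 (by rintro _ ⟨k, rfl⟩; exact hall k)
    exact hd (TopologicalSpace.denseRange_denseSeq (Fin p → ℝ) v)
  refine (measure_mono hsub).trans ?_
  rw [hT.measure_iUnion]
  exact iSup_le fun N => measure_exists_not_lowerBoundAt_le hn hG hS fun k : Fin N => d k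

end Main

theorem lemma1 :
    ∃ c₁ : ℝ, 0 < c₁ ∧ ∃ c₂ : ℝ, 0 < c₂ ∧
      ∀ (n p : ℕ) (G : SimpleGraph (Fin p)) [DecidableRel G.Adj]
        (Sig : Matrix (Fin p) (Fin p) ℝ)
        (Ω : Type*) [MeasurableSpace Ω] (P : Measure Ω) [IsProbabilityMeasure P]
        (X : Ω → Matrix (Fin n) (Fin p) ℝ),
        10 ≤ n → 2 ≤ G.edgeFinset.card → Sig.PosSemidef →
        (∀ i : Fin n,
          HasLaw (fun ω => WithLp.toLp 2 (X ω i)) (multivariateGaussian 0 Sig) P) →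
        iIndepFun (fun (i : Fin n) ω => WithLp.toLp 2 (X ω i)) P →
        1 - c₁ * Real.exp (-c₂ * n) ≤
          P.real {ω | ∀ v : Fin p → ℝ,
            (1 / 4) * l2Norm (CFC.sqrt Sig *ᵥ v)
              - 3 * √(maxEigenvalue Sig * Nat.card G.ConnectedComponent / n) * l2Norm v
              - 6 * √2 * invScaling (incidence G) * √(maxEigenvalue Sig * Real.log p / n)
                * l1Norm (incidence G *ᵥ v)
            ≤ l2Norm (X ω *ᵥ v) / √n} := by
  refine ⟨2 * Real.exp 1, by positivity, 1 / 2000, by norm_num, ?_⟩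
  intro n p G _ Sig Ω _ P _ X hn hG hS hX hind
  have hn0 : 0 < n := by omega
  set ν := Measure.pi fun _ : Fin n => multivariateGaussian 0 Sig with hν
  set α := 3 * √(maxEigenvalue Sig * Nat.card G.ConnectedComponent / n) with hα
  set β := 6 * √2 * invScaling (incidence G) * √(maxEigenvalue Sig * Real.log p / n) with hβ
  let Y : Ω → Fin n → EuclideanSpace ℝ (Fin p) := fun ω i => WithLp.toLp 2 (X ω i)
  have hYm : AEMeasurable Y P := aemeasurable_pi_lambda _ fun i => (hX i).aemeasurable
  have hY : P.map Y = ν := by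
    have h := hind.map_fun_eq_pi_map fun i => (hX i).aemeasurable
    simp only [fun i => (hX i).map_eq] at h
    exact h
  set good : Set (Fin n → EuclideanSpace ℝ (Fin p)) := {x | ∀ v, LowerBoundAt G Sig α β x v}
    with hgood
  have hgm : MeasurableSet good := by
    have : good = ⋂ v, {x | LowerBoundAt G Sig α β x v} := by
      ext x; simp [hgood]
    rw [this]
    exact (isClosed_iInter fun v => isClosed_setOf_lowerBoundAt v).measurableSet
  have hset : {ω | ∀ v : Fin p → ℝ,
      (1 / 4) * l2Norm (CFC.sqrt Sig *ᵥ v) - α * l2Norm v - β * l1Norm (incidence G *ᵥ v)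
        ≤ l2Norm (X ω *ᵥ v) / √n} = Y ⁻¹' good := by
    ext ω
    refine forall_congr' fun v => ?_
    rw [LowerBoundAt]
    have : (fun i => dualOf v (Y ω i)) = X ω *ᵥ v := by
      ext i; rw [dualOf_apply]; rfl
    rw [this]
  have hbad : ν.real goodᶜ ≤ 2 * Real.exp 1 * Real.exp (-(1 / 2000) * n) :=
    ENNReal.toReal_le_of_le_ofReal (by positivity) (measure_not_forall_lowerBoundAt_le hn0 hG hS)
  have hP : P.real (Y ⁻¹' good) = ν.real good := by
    rw [← hY, Measure.real, Measure.real, Measure.map_apply_of_aemeasurable hYm hgm]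
  rw [hset, hP]
  rw [probReal_compl_eq_one_sub hgm] at hbad
  linarith
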